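/- **Proposition 3.1.** Let $K$ be a field of characteristic $0$, let $N\ge 1$ be an integer, and let $q\in K$ satisfy $q\neq 0$ and $q^8\neq 1$. Let $a_{ij}$ $(1\le i,j\le N)$ be the Cartan matrix of type $A_N$: $a_{ii}=2$, $a_{ij}=-1$ if $|i-j|=1$, and $a_{ij}=0$ otherwise. Let $U_q(A_N)$ be the $K$-algebra with generators $E_i,F_i,K_i,K_i^{-1}$ $(1\le i\le N)$ and the relations $$K_iK_j=K_jK_i,\qquad K_iK_i^{-1}=K_i^{-1}K_i=1,\qquad E_jK_i^{\pm1}=q^{\mp a_{ij}}K_i^{\pm1}E_j,\qquad K_i^{\pm1}F_j=q^{\mp a_{ij}}F_jK_i^{\pm1},$$ $$E_iF_j-F_jE_i=\delta_{ij}\frac{K_i^2-K_i^{-2}}{q^2-q^{-2}},$$ $$\sum_{v=0}^{1-a_{ij}}(-1)^v\begin{bmatrix}1-a_{ij}\\ v\end{bmatrix}_{q^2}E_i^{1-a_{ij}-v}E_jE_i^{v}=0=\sum_{v=0}^{1-a_{ij}}(-1)^v\begin{bmatrix}1-a_{ij}\\ v\end{bmatrix}_{q^2}F_i^{1-a_{ij}-v}F_jF_i^{v}\qquad(i\ne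 j),$$ where $\begin{bmatrix}m\\ n\end{bmatrix}_{t}=\prod_{i=1}^{n}\frac{t^{m+1-i}-t^{-(m+1-i)}}{t^{i}-t^{-i}}$ for $0<n<m$, and it is $1$ for $n=0$ and for $n=m$. Let $U_q^+(A_N)$ and $U_q^-(A_N)$ be the subalgebras of $U_q(A_N)$ generated by $E_1,\dots,E_N$ and by $F_1,\dots,F_N$ respectively. Let $\Lambda_N=\{(i,j)\mid 1\le i<j\le N+1\}$ with its lexicographic ordering $<_{lex}$, and let $K\langle X\rangle$ be the free algebra on $X=\{X_{ij}\mid (i,j)\in\Lambda_N\}$. For pairs $((i,j),(m,n))\in\Lambda_N\times\Lambda_N$ let $C_1,\dots,C_6$ be given by $$\begin{array}{lll}C_1:\ i=m<j<n, & C_2:\ i<m<n<j, & C_3:\ i<m<j=n,\\ C_4:\ i<m<j<n, & C_5:\ i<j=m<n, & C_6:\ i<j<m<n.\end{array}$$ Let $\mathcal G\subset K\langle X\rangle$ be the set of Jimbo relations $$\begin{array}{ll}X_{mn}X_{ij}-q^{-2}X_{ij}X_{mn}, & ((i,j),(m,n))\in C_1\cup C_3,\\ X_{mn}X_{ij}-X_{ij}X_{mn},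 & ((i,j),(m,n))\in C_2\cup C_6,\\ X_{mn}X_{ij}-X_{ij}X_{mn}+(q^2-q^{-2})X_{in}X_{mj}, & ((i,j),(m,n))\in C_4,\\ X_{mn}X_{ij}-q^2X_{ij}X_{mn}+qX_{in}, & ((i,j),(m,n))\in C_5,\end{array}$$ and let $\langle\mathcal G\rangle$ be the two-sided ideal that it generates. Then: 1. $\mathcal G$ is a set of defining relations of $U_q^+(A_N)$: there are generators $x_{ij}$, $(i,j)\in\Lambda_N$, of the algebra $U_q^+(A_N)$, with $x_{i,i+1}=E_i$ for $1\le i\le N$, such that the kernel of the homomorphism $K\langle X\rangle\to U_q^+(A_N)$, $X_{ij}\mapsto x_{ij}$, is $\langle\mathcal G\rangle$. 2. Likewise $\mathcal G$ is a set of defining relations of $U_q^-(A_N)$, for generators $y_{ij}$ with $y_{i,i+1}=F_i$ for $1\le i\le N$. 3. There is a monomial ordering $\prec$ on $K\langle X\rangle$ such that $\mathcal G$ is a Gröbner basis of $\langle\mathcal G\rangle$ and the set of leading monomials of the elements of $\mathcal G$ is $$\mathbf{LM}(\mathcal G)=\{X_{mn}X_{ij}\mid ((i,j),(m,n))\in C_1\cup\dots\cup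 C_6,\ (i,j)<_{lex}(m,n)\}.$$ Here a monomial ordering is a total well-ordering $\prec$ on the set of words in the letters $X_{ij}$ such that $b\prec c$ whenever $c=abe\neq 1$ and $b\ne c$, and such that $a\prec b$ implies $cae\prec cbe$, for all words $a,b,c,e$. The leading monomial of a nonzero element is the largest word that occurs in it. A subset $G$ of a two-sided ideal $I$ is a Gröbner basis of $I$ if the leading monomial of every nonzero element of $I$ is of the form $aub$ with words $a,b$ and $u$ the leading monomial of some element of $G$. -/

import Mathlib

noncomputable section

/-! ### Gröbner bases in free algebras

Words in the letters `σ` are the elements of `FreeMonoid σ`; they form the standard basis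
`FreeAlgebra.basisFreeMonoid` of the free algebra. -/

/-- `r` (read `r u v` as `u ≺ v`) is a monomial ordering on the words in `σ`: a strict total
well-ordering under which a proper factor of a word is smaller than that word, and which is
compatible with multiplication on both sides. -/
structure IsMonomialOrdering {σ : Type*} (r : FreeMonoid σ → FreeMonoid σ → Prop) : Prop where
  isWellOrder : IsWellOrder (FreeMonoid σ) r
  factor_lt : ∀ a b e c : FreeMonoid σ, c ≠ 1 → b ≠ c → c = a * b * e → r b c
  mul_lt_mul : ∀ a b c e : FreeMonoid σ, r a b → r (c * a * e) (c * b * e)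

/-- `w` is the leading monomial of `f`: it occurs in `f` with nonzero coefficient, and every other
word occurring in `f` is smaller. -/
def IsLeadingMonomial {K σ : Type*} [Field K] (r : FreeMonoid σ → FreeMonoid σ → Prop)
    (f : FreeAlgebra K σ) (w : FreeMonoid σ) : Prop :=
  (FreeAlgebra.basisFreeMonoid K σ).repr f w ≠ 0 ∧
    ∀ v, (FreeAlgebra.basisFreeMonoid K σ).repr f v ≠ 0 → v ≠ w → r v w

/-- The set of leading monomials of the (nonzero) elements of `G`. -/
def leadingMonomials {K σ : Type*} [Field K] (r : FreeMonoid σ → FreeMonoid σ → Prop)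
    (G : Set (FreeAlgebra K σ)) : Set (FreeMonoid σ) :=
  {w | ∃ g ∈ G, IsLeadingMonomial r g w}

/-- `G` is a Gröbner basis of the two-sided ideal `I`: it is contained in `I`, and the leading
monomial of every nonzero element of `I` is a two-sided multiple of the leading monomial of some
element of `G`. -/
def IsGroebnerBasis {K σ : Type*} [Field K] (r : FreeMonoid σ → FreeMonoid σ → Prop)
    (G : Set (FreeAlgebra K σ)) (I : TwoSidedIdeal (FreeAlgebra K σ)) : Prop :=
  (∀ g ∈ G, g ∈ I) ∧
    ∀ f ∈ I, f ≠ 0 → ∀ w, IsLeadingMonomial r f w →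
      ∃ u ∈ leadingMonomials r G, ∃ a b : FreeMonoid σ, w = a * u * b

/-- The elements `x s` of the algebra `A` generate the subalgebra `U`, and `G` is a set of defining
relations of `U` for these generators: the relations between them are the two-sided ideal
generated by `G`. -/
def IsDefiningSet {K A σ : Type*} [Field K] [Ring A] [Algebra K A] (U : Subalgebra K A)
    (x : σ → A) (G : Set (FreeAlgebra K σ)) : Prop :=
  Algebra.adjoin K (Set.range x) = U ∧
    ∀ f : FreeAlgebra K σ, FreeAlgebra.lift K x f = 0 ↔ f ∈ TwoSidedIdeal.span G

/-! ### The Drinfeld-Jimbo quantum group of type `A_N` -/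

/-- The symbols `E_i`, `F_i`, `K_i`, `K_i⁻¹`. -/
inductive QuantumGen (N : ℕ) : Type
  | genE (i : Fin N)
  | genF (i : Fin N)
  | genK (i : Fin N)
  | genKInv (i : Fin N)

/-- The quantum binomial coefficient `[m choose n]_t`. -/
def quantumBinomial {K : Type*} [Field K] (t : K) (m n : ℕ) : K :=
  if n = 0 ∨ n = m then 1
  else ∏ i ∈ Finset.Icc 1 n,
    (t ^ ((m : ℤ) + 1 - i) - t ^ ((i : ℤ) - m - 1)) / (t ^ (i : ℤ) - t ^ (-(i : ℤ)))

/-- The quantum Serre expression in `x`, `y` for the entry `c` of the Cartan matrix. -/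
def quantumSerre {K A : Type*} [Field K] [Ring A] [Algebra K A] (t : K) (c : ℤ) (x y : A) : A :=
  ∑ v ∈ Finset.range ((1 - c).toNat + 1),
    ((-1 : K) ^ v * quantumBinomial t (1 - c).toNat v) • (x ^ ((1 - c).toNat - v) * y * x ^ v)

open QuantumGen in
/-- The defining relations of the quantum group. The Cartan matrix has all `d_i = 1`. -/
inductive QuantumRel {K : Type*} [Field K] (N : ℕ) (q : K) :
    FreeAlgebra K (QuantumGen N) → FreeAlgebra K (QuantumGen N) → Prop
  | k_comm (i j : Fin N) : QuantumRel N q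
      (FreeAlgebra.ι K (genK i) * FreeAlgebra.ι K (genK j))
      (FreeAlgebra.ι K (genK j) * FreeAlgebra.ι K (genK i))
  | k_kInv (i : Fin N) : QuantumRel N q
      (FreeAlgebra.ι K (genK i) * FreeAlgebra.ι K (genKInv i)) 1
  | kInv_k (i : Fin N) : QuantumRel N q
      (FreeAlgebra.ι K (genKInv i) * FreeAlgebra.ι K (genK i)) 1
  | e_k (i j : Fin N) : QuantumRel N q
      (FreeAlgebra.ι K (genE j) * FreeAlgebra.ι K (genK i))
      (q ^ (-CartanMatrix.A N i j) • (FreeAlgebra.ι K (genK i) * FreeAlgebra.ι K (genE j)))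
  | e_kInv (i j : Fin N) : QuantumRel N q
      (FreeAlgebra.ι K (genE j) * FreeAlgebra.ι K (genKInv i))
      (q ^ (CartanMatrix.A N i j) • (FreeAlgebra.ι K (genKInv i) * FreeAlgebra.ι K (genE j)))
  | k_f (i j : Fin N) : QuantumRel N q
      (FreeAlgebra.ι K (genK i) * FreeAlgebra.ι K (genF j))
      (q ^ (-CartanMatrix.A N i j) • (FreeAlgebra.ι K (genF j) * FreeAlgebra.ι K (genK i)))
  | kInv_f (i j : Fin N) : QuantumRel N q
      (FreeAlgebra.ι K (genKInv i) * FreeAlgebra.ι K (genF j))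
      (q ^ (CartanMatrix.A N i j) • (FreeAlgebra.ι K (genF j) * FreeAlgebra.ι K (genKInv i)))
  | e_f (i j : Fin N) : QuantumRel N q
      (FreeAlgebra.ι K (genE i) * FreeAlgebra.ι K (genF j)
        - FreeAlgebra.ι K (genF j) * FreeAlgebra.ι K (genE i))
      (if i = j then (q ^ 2 - (q ^ 2)⁻¹)⁻¹ •
        (FreeAlgebra.ι K (genK i) ^ 2 - FreeAlgebra.ι K (genKInv i) ^ 2) else 0)
  | serre_e (i j : Fin N) (h : i ≠ j) : QuantumRel N q
      (quantumSerre (q ^ 2) (CartanMatrix.A N i j)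
        (FreeAlgebra.ι K (genE i)) (FreeAlgebra.ι K (genE j))) 0
  | serre_f (i j : Fin N) (h : i ≠ j) : QuantumRel N q
      (quantumSerre (q ^ 2) (CartanMatrix.A N i j)
        (FreeAlgebra.ι K (genF i)) (FreeAlgebra.ι K (genF j))) 0

/-- The Drinfeld-Jimbo quantum group `U_q(A_N)`. -/
abbrev QuantumGroup {K : Type*} [Field K] (N : ℕ) (q : K) : Type _ :=
  RingQuot (QuantumRel N q)

/-- The generator `E_i` of `U_q(A_N)`. -/
def quantumE {K : Type*} [Field K] {N : ℕ} (q : K) (i : Fin N) : QuantumGroup N q :=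
  RingQuot.mkAlgHom K (QuantumRel N q) (FreeAlgebra.ι K (QuantumGen.genE i))

/-- The generator `F_i` of `U_q(A_N)`. -/
def quantumF {K : Type*} [Field K] {N : ℕ} (q : K) (i : Fin N) : QuantumGroup N q :=
  RingQuot.mkAlgHom K (QuantumRel N q) (FreeAlgebra.ι K (QuantumGen.genF i))

/-- `U_q^+(A_N)`, the subalgebra generated by the `E_i`. -/
def quantumPlus {K : Type*} [Field K] (N : ℕ) (q : K) : Subalgebra K (QuantumGroup N q) :=
  Algebra.adjoin K (Set.range (quantumE (N := N) q))

/-- `U_q^-(A_N)`, the subalgebra generated by the `F_i`. -/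
def quantumMinus {K : Type*} [Field K] (N : ℕ) (q : K) : Subalgebra K (QuantumGroup N q) :=
  Algebra.adjoin K (Set.range (quantumF (N := N) q))

/-! ### The Jimbo relations -/

/-- The index set `Λ_N` of pairs `i < j` among `N + 1` numbers. The numbers are `0, …, N` here,
instead of `1, …, N + 1`; only their order matters. -/
abbrev RootIndex (N : ℕ) : Type := {p : Fin (N + 1) × Fin (N + 1) // p.1 < p.2}

/-- The pair `(i, i + 1)`. -/
def simpleIndex {N : ℕ} (i : Fin N) : RootIndex N :=
  ⟨(i.castSucc, i.succ), Fin.castSucc_lt_succ⟩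

/-- The lexicographic ordering on `Λ_N`. -/
def LexLT {N : ℕ} (a b : RootIndex N) : Prop :=
  a.1.1 < b.1.1 ∨ a.1.1 = b.1.1 ∧ a.1.2 < b.1.2

/-- `((i,j),(m,n))` with `i = m < j < n`. -/
def jimboC1 (N : ℕ) : Set (RootIndex N × RootIndex N) :=
  {p | p.1.1.1 = p.2.1.1 ∧ p.2.1.1 < p.1.1.2 ∧ p.1.1.2 < p.2.1.2}

/-- `((i,j),(m,n))` with `i < m < n < j`. -/
def jimboC2 (N : ℕ) : Set (RootIndex N × RootIndex N) :=
  {p | p.1.1.1 < p.2.1.1 ∧ p.2.1.1 < p.2.1.2 ∧ p.2.1.2 < p.1.1.2}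

/-- `((i,j),(m,n))` with `i < m < j = n`. -/
def jimboC3 (N : ℕ) : Set (RootIndex N × RootIndex N) :=
  {p | p.1.1.1 < p.2.1.1 ∧ p.2.1.1 < p.1.1.2 ∧ p.1.1.2 = p.2.1.2}

/-- `((i,j),(m,n))` with `i < m < j < n`. -/
def jimboC4 (N : ℕ) : Set (RootIndex N × RootIndex N) :=
  {p | p.1.1.1 < p.2.1.1 ∧ p.2.1.1 < p.1.1.2 ∧ p.1.1.2 < p.2.1.2}

/-- `((i,j),(m,n))` with `i < j = m < n`. -/
def jimboC5 (N : ℕ) : Set (RootIndex N × RootIndex N) :=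
  {p | p.1.1.1 < p.1.1.2 ∧ p.1.1.2 = p.2.1.1 ∧ p.2.1.1 < p.2.1.2}

/-- `((i,j),(m,n))` with `i < j < m < n`. -/
def jimboC6 (N : ℕ) : Set (RootIndex N × RootIndex N) :=
  {p | p.1.1.1 < p.1.1.2 ∧ p.1.1.2 < p.2.1.1 ∧ p.2.1.1 < p.2.1.2}

/-- The letter `X_ij` of the free algebra. -/
def letterX (K : Type*) [Field K] {N : ℕ} (i j : Fin (N + 1)) (h : i < j) :
    FreeAlgebra K (RootIndex N) :=
  FreeAlgebra.ι K ⟨(i, j), h⟩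

/-- The set `𝒢` of Jimbo relations. -/
inductive JimboRelation {K : Type*} [Field K] (N : ℕ) (q : K) : FreeAlgebra K (RootIndex N) → Prop
  | f13 (i j m n : Fin (N + 1)) (hij : i < j) (hmn : m < n)
      (h : ((⟨(i, j), hij⟩, ⟨(m, n), hmn⟩) : RootIndex N × RootIndex N) ∈
        jimboC1 N ∪ jimboC3 N) :
      JimboRelation N q (letterX K m n hmn * letterX K i j hij
        - (q ^ 2)⁻¹ • (letterX K i j hij * letterX K m n hmn))
  | f26 (i j m n : Fin (N + 1)) (hij : i < j) (hmn : m < n)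
      (h : ((⟨(i, j), hij⟩, ⟨(m, n), hmn⟩) : RootIndex N × RootIndex N) ∈
        jimboC2 N ∪ jimboC6 N) :
      JimboRelation N q (letterX K m n hmn * letterX K i j hij
        - letterX K i j hij * letterX K m n hmn)
  | f4 (i j m n : Fin (N + 1)) (hij : i < j) (hmn : m < n) (hin : i < n) (hmj : m < j)
      (h : ((⟨(i, j), hij⟩, ⟨(m, n), hmn⟩) : RootIndex N × RootIndex N) ∈ jimboC4 N) :
      JimboRelation N q (letterX K m n hmn * letterX K i j hij
        - letterX K i j hij * letterX K m n hmn
        + (q ^ 2 - (q ^ 2)⁻¹) • (letterX K i n hin * letterX K m j hmj))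
  | f5 (i j m n : Fin (N + 1)) (hij : i < j) (hmn : m < n) (hin : i < n)
      (h : ((⟨(i, j), hij⟩, ⟨(m, n), hmn⟩) : RootIndex N × RootIndex N) ∈ jimboC5 N) :
      JimboRelation N q (letterX K m n hmn * letterX K i j hij
        - q ^ 2 • (letterX K i j hij * letterX K m n hmn)
        + q • letterX K i n hin)

/-- The set `𝒢` of Jimbo relations. -/
def jimboRelations {K : Type*} [Field K] (N : ℕ) (q : K) : Set (FreeAlgebra K (RootIndex N)) :=
  {f | JimboRelation N q f}

end

/-! Write p = q². The generators are the root vectors x_{i,i+1} = E_i and x_{i,j+1} = q x_{ij} E_j -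
q⁻¹ E_j x_{ij}. The Serre relations imply the Jimbo relations for them. For the degree-lexicographic
ordering, the leading word of a Jimbo relation is a descent X_b X_a with a < b, and every descent
occurs. Hence every word is congruent modulo ⟨𝒢⟩ to a combination of weakly increasing words. If the
ordered monomials in the x_{ij} are linearly independent, then no nonzero combination of weakly
increasing words is a relation. This gives at once the kernel (`map_eq_zero_iff_mem_span`) and the
Gröbner property (`isGroebnerBasis_of_linearIndependent`), and no overlaps have to be resolved.

The independence comes from representations of the Serre relations, built row by row
(`exists_linearIndependent_wordProd`). Given one on W in which E_k = 0 for k ≤ r, consider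
polynomials in t_r, …, t_{N-1} with coefficients in W, and let E_k + t_k act for r ≤ k < N, twisted
so that t_k passes E_j with the scalar p^{a_kj}. The Serre relations survive. Since E_r = 0, the
vector x_{rj} acts as a nonzero multiple of a twisted multiplication by t_r ⋯ t_{j-1}
(`rootVector_extendOp`), while the vectors of later rows act on constant terms as before. So the
lowest term of an ordered monomial shows its row r in the exponent and the remaining rows in the
coefficient, and a downward induction on r applies.

This settles the algebra defined by the Serre relations alone. To see that the E_i satisfy no
further relations in the quantum group, the latter is made to act on the Serre algebra: E_i by left
multiplication, K_i by rescaling generators, F_i by a difference of two skew derivations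
(`quantumAction`). The Chevalley involution transfers the result to the F_i. The hypothesis q⁸ ≠ 1
enters as p - p⁻¹ ≠ 0 and p + p⁻¹ ≠ 0. -/

noncomputable section

/-! ### Root vectors and the relations between them -/

section RootVectors

variable {K A : Type*} [Field K] [Ring A] [Algebra K A]

/-- `z` and `a` commute up to the scalar `s`. -/
def QCommute (s : K) (z a : A) : Prop := z * a = s • (a * z)

/-- The bracket `q a b - q⁻¹ b a`. -/
def qBracket (q : K) (a b : A) : A := q • (a * b) - q⁻¹ • (b * a)

/-- The cubic Serre expression `a² b - (p + p⁻¹) a b a + b a²`. -/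
def cubicSerre (p : K) (a b : A) : A :=
  a * (a * b) - (p + p⁻¹) • (a * (b * a)) + b * (a * a)

theorem QCommute.mul_right {s u : K} {z a b : A} (ha : QCommute s z a) (hb : QCommute u z b) :
    QCommute (s * u) z (a * b) := by
  unfold QCommute at *
  rw [← mul_assoc, ha, smul_mul_assoc, mul_assoc, hb, mul_smul_comm, smul_smul, mul_assoc]

theorem QCommute.mul_left {s u : K} {z w a : A} (hz : QCommute s z a) (hw : QCommute u w a) :
    QCommute (s * u) (z * w) a := by
  unfold QCommute at *
  rw [mul_assoc, hw, mul_smul_comm, ← mul_assoc, hz, smul_mul_assoc, smul_smul, mul_assoc,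
    mul_comm u]

theorem QCommute.bracket_right {s u q : K} {z a b : A} (ha : QCommute s z a)
    (hb : QCommute u z b) : QCommute (s * u) z (qBracket q a b) := by
  have h1 := ha.mul_right hb
  have h2 := hb.mul_right ha
  unfold QCommute qBracket at *
  rw [mul_sub, mul_smul_comm, mul_smul_comm, h1, h2, sub_mul, smul_mul_assoc, smul_mul_assoc]
  module

theorem QCommute.bracket_left {s u q : K} {z w a : A} (hz : QCommute s z a)
    (hw : QCommute u w a) : QCommute (s * u) (qBracket q z w) a := by
  have h1 := hz.mul_left hw
  have h2 := hw.mul_left hz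
  unfold QCommute qBracket at *
  rw [sub_mul, smul_mul_assoc, smul_mul_assoc, h1, h2, mul_sub, mul_smul_comm, mul_smul_comm]
  module

theorem QCommute.symm {s : K} (hs : s ≠ 0) {z a : A} (h : QCommute s z a) :
    QCommute s⁻¹ a z := by
  unfold QCommute at *
  rw [h, smul_smul, inv_mul_cancel₀ hs, one_smul]

theorem qCommute_one_iff {z a : A} : QCommute (1 : K) z a ↔ z * a = a * z := by
  rw [QCommute, one_smul]

theorem qCommute_zero_right (s : K) (z : A) : QCommute s z 0 := by simp [QCommute]

theorem qCommute_zero_left (s : K) (z : A) : QCommute s 0 z := by simp [QCommute]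

/-- The outer terms of the two expansions agree, and the middle ones are exchanged by a c = c a.
This is what allows a root vector to be cut at any intermediate index. -/
theorem qBracket_assoc (q : K) {a b c : A} (h : a * c = c * a) :
    qBracket q (qBracket q a b) c = qBracket q a (qBracket q b c) := by
  have h1 : ∀ x, a * (c * x) = c * (a * x) := fun x => by
    rw [← mul_assoc, h, mul_assoc]
  simp only [qBracket, mul_sub, sub_mul, mul_smul_comm, smul_mul_assoc, smul_sub, smul_smul,
    mul_assoc, h, h1]
  module

/-- The Serre relations of type `A` for the family `E`. -/
structure SerreRelations (p : K) (E : ℕ → A) : Prop where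
  comm : ∀ i j, i + 1 < j → E i * E j = E j * E i
  cubic_succ : ∀ i, cubicSerre p (E i) (E (i + 1)) = 0
  cubic_pred : ∀ i, cubicSerre p (E (i + 1)) (E i) = 0

/-- The root vectors `x i j`, for `i < j`, with `x i (i + 1) = E i`. -/
def rootVector (q : K) (E : ℕ → A) (i : ℕ) : ℕ → A
  | 0 => 0
  | j + 1 => if j = i then E i else qBracket q (rootVector q E i j) (E j)

@[simp]
theorem rootVector_simple (q : K) (E : ℕ → A) (i : ℕ) : rootVector q E i (i + 1) = E i := by
  simp [rootVector]

theorem rootVector_succ (q : K) (E : ℕ → A) {i j : ℕ} (h : i < j) :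
    rootVector q E i (j + 1) = qBracket q (rootVector q E i j) (E j) := by
  rw [rootVector, if_neg (by omega)]

theorem rootVector_map {B : Type*} [Ring B] [Algebra K B] (φ : A →ₐ[K] B) (q : K) (E : ℕ → A)
    (i j : ℕ) : φ (rootVector q E i j) = rootVector q (fun k => φ (E k)) i j := by
  induction j with
  | zero => simp [rootVector]
  | succ j ih =>
    by_cases h : j = i
    · simp [rootVector, h]
    · simp [rootVector, h, qBracket, ih]

theorem rootVector_mem (S : Subalgebra K A) (q : K) (E : ℕ → A) (hE : ∀ k, E k ∈ S) (i j : ℕ) :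
    rootVector q E i j ∈ S := by
  induction j with
  | zero => exact S.zero_mem
  | succ j ih =>
    rw [rootVector]
    split_ifs
    · exact hE i
    · exact S.sub_mem (S.smul_mem (S.mul_mem ih (hE j)) _) (S.smul_mem (S.mul_mem (hE j) ih) _)

/-- An element commuting up to scalars `s k` with the `E k` commutes with the root vectors up to
the product of these scalars. -/
theorem qCommute_rootVector (q : K) (E : ℕ → A) (z : A) (s : ℕ → K) {i j : ℕ} (hij : i < j)
    (h : ∀ k, i ≤ k → k < j → QCommute (s k) z (E k)) :
    QCommute (∏ k ∈ Finset.Ico i j, s k) z (rootVector q E i j) := by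
  induction j, hij using Nat.le_induction with
  | base => simpa using h i le_rfl (Nat.lt_succ_self i)
  | succ j hj ih =>
    rw [rootVector_succ q E hj, Finset.prod_Ico_succ_top (by omega)]
    exact (ih fun k h1 h2 => h k h1 (by omega)).bracket_right (h j (by omega) (by omega))

theorem commute_rootVector (q : K) (E : ℕ → A) (z : A) {i j : ℕ} (hij : i < j)
    (h : ∀ k, i ≤ k → k < j → z * E k = E k * z) :
    z * rootVector q E i j = rootVector q E i j * z := by
  rw [← qCommute_one_iff (K := K)]
  simpa using qCommute_rootVector q E z (fun _ => 1) hij fun k h1 h2 =>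
    qCommute_one_iff.2 (h k h1 h2)

/-- A cubic Serre relation is the same thing as a commutation up to p⁻¹: the defect is -q⁻¹ times
the Serre expression. The next lemma is the mirror image. -/
theorem qCommute_bracket_pred {p q : K} (hq0 : q ≠ 0) (hp : p = q ^ 2) {a b : A}
    (h : cubicSerre p b a = 0) : QCommute p⁻¹ b (qBracket q a b) := by
  have key : b * qBracket q a b - p⁻¹ • (qBracket q a b * b) = -q⁻¹ • cubicSerre p b a := by
    simp only [qBracket, cubicSerre, mul_sub, sub_mul, mul_smul_comm, smul_mul_assoc, mul_assoc, hp]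
    match_scalars <;> field_simp <;> ring
  rw [h, smul_zero, sub_eq_zero] at key
  exact key

theorem bracket_qCommute_succ {p q : K} (hq0 : q ≠ 0) (hp : p = q ^ 2) {a b : A}
    (h : cubicSerre p a b = 0) : QCommute p⁻¹ (qBracket q a b) a := by
  have key : qBracket q a b * a - p⁻¹ • (a * qBracket q a b) = -q⁻¹ • cubicSerre p a b := by
    simp only [qBracket, cubicSerre, mul_sub, sub_mul, mul_smul_comm, smul_mul_assoc, mul_assoc, hp]
    match_scalars <;> field_simp <;> ring
  rw [h, smul_zero, sub_eq_zero] at key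
  exact key

/-- The middle simple root vector commutes with the root vector of length three. -/
theorem commute_bracket_bracket {p q : K} (hq0 : q ≠ 0) (hp : p = q ^ 2) (hp2 : p + p⁻¹ ≠ 0)
    {a b c : A} (hac : a * c = c * a) (h1 : cubicSerre p b a = 0) (h2 : cubicSerre p b c = 0) :
    b * qBracket q (qBracket q a b) c = qBracket q (qBracket q a b) c * b := by
  have hca : ∀ x, c * (a * x) = a * (c * x) := fun x => by rw [← mul_assoc, ← hac, mul_assoc]
  -- Only p + p⁻¹ times the commutator is a combination of Serre expressions, which is why this
  -- scalar has to be invertible.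
  have key : (p + p⁻¹) • (b * qBracket q (qBracket q a b) c - qBracket q (qBracket q a b) c * b)
      = p • (a * cubicSerre p b c) + p⁻¹ • (c * cubicSerre p b a)
        - p • (cubicSerre p b a * c) - p⁻¹ • (cubicSerre p b c * a) := by
    simp only [qBracket, cubicSerre, mul_sub, sub_mul, add_mul, mul_add, mul_smul_comm,
      smul_mul_assoc, mul_assoc, hp, ← hac, hca]
    match_scalars <;> field_simp <;> ring
  rw [h1, h2] at key
  simp only [mul_zero, zero_mul, smul_zero, sub_zero, add_zero, smul_eq_zero, hp2, false_or] at key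
  exact sub_eq_zero.1 key

section Jimbo

variable {p q : K} {E : ℕ → A} (hq0 : q ≠ 0) (hp : p = q ^ 2) (hp2 : p + p⁻¹ ≠ 0)
  (hE : SerreRelations p E)
include hE

theorem SerreRelations.comm_symm {i j : ℕ} (h : i + 1 < j ∨ j + 1 < i) : E i * E j = E j * E i := by
  rcases h with h | h
  · exact hE.comm i j h
  · exact (hE.comm j i h).symm

/-- The Jimbo relation for `i < j < m < n`. -/
theorem SerreRelations.commute_of_disjoint {i j m n : ℕ} (hij : i < j) (hjm : j < m)
    (hmn : m < n) :
    rootVector q E m n * rootVector q E i j = rootVector q E i j * rootVector q E m n := by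
  refine commute_rootVector q E _ hij fun k h1 h2 => ?_
  refine (commute_rootVector q E _ hmn fun l h3 h4 => ?_).symm
  exact hE.comm k l (by omega)

/-- Induction on n: the new factor E n commutes with x_{ij} because j < n, so the brackets can be
reassociated. -/
theorem SerreRelations.bracket_rootVector {i j n : ℕ} (hij : i < j) (hjn : j < n) :
    rootVector q E i n = qBracket q (rootVector q E i j) (rootVector q E j n) := by
  induction n, hjn using Nat.le_induction with
  | base => rw [rootVector_succ q E hij, rootVector_simple]
  | succ n hn ih =>
    rw [rootVector_succ q E (by omega), ih, rootVector_succ q E hn, qBracket_assoc]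
    refine (commute_rootVector q E _ hij fun k h1 h2 => ?_).symm
    exact hE.comm_symm (by omega)

include hq0 hp

/-- Only the last two simple factors of the root vector matter. The part cut off before them
commutes with E j. -/
theorem SerreRelations.last_qCommute {i j : ℕ} (hij : i < j) :
    QCommute p⁻¹ (E j) (rootVector q E i (j + 1)) := by
  have base : ∀ i, QCommute p⁻¹ (E (i + 1)) (rootVector q E i (i + 2)) := fun i => by
    rw [rootVector_succ q E (Nat.lt_succ_self i), rootVector_simple]
    exact qCommute_bracket_pred hq0 hp (hE.cubic_pred i)
  obtain ⟨j, rfl⟩ : ∃ k, j = k + 1 := ⟨j - 1, by omega⟩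
  rcases eq_or_lt_of_le (Nat.le_of_lt_succ hij) with rfl | h
  · exact base i
  · rw [hE.bracket_rootVector h (show j < j + 1 + 1 by omega)]
    have h1 : QCommute (1 : K) (E (j + 1)) (rootVector q E i j) := by
      rw [qCommute_one_iff]
      exact commute_rootVector q E _ h fun k _ _ => hE.comm_symm (by omega)
    simpa using h1.bracket_right (q := q) (base j)

theorem SerreRelations.first_qCommute {i j : ℕ} (hij : i + 1 < j) :
    QCommute p⁻¹ (rootVector q E i j) (E i) := by
  have base : QCommute p⁻¹ (rootVector q E i (i + 2)) (E i) := by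
    rw [rootVector_succ q E (Nat.lt_succ_self i), rootVector_simple]
    exact bracket_qCommute_succ hq0 hp (hE.cubic_succ i)
  rcases eq_or_lt_of_le (show i + 2 ≤ j from hij) with rfl | h
  · exact base
  · rw [hE.bracket_rootVector (show i < i + 2 by omega) h]
    have h1 : QCommute (1 : K) (rootVector q E (i + 2) j) (E i) := by
      rw [qCommute_one_iff]
      exact (commute_rootVector q E _ h fun k _ _ => hE.comm_symm (by omega)).symm
    simpa using base.bracket_left (q := q) h1

include hp2

/-- The root vector is cut on both sides of the three factors E (m - 1), E m, E (m + 1). The outer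
pieces commute with E m, and the middle piece is the case of length three. -/
theorem SerreRelations.middle_commute {i j m : ℕ} (him : i < m) (hmj : m + 1 < j) :
    E m * rootVector q E i j = rootVector q E i j * E m := by
  obtain ⟨m, rfl⟩ : ∃ k, m = k + 1 := ⟨m - 1, by omega⟩
  have base : QCommute (1 : K) (E (m + 1)) (rootVector q E m (m + 3)) := by
    rw [qCommute_one_iff, rootVector_succ q E (show m < m + 2 by omega),
      rootVector_succ q E (Nat.lt_succ_self m), rootVector_simple]
    exact commute_bracket_bracket hq0 hp hp2 (hE.comm _ _ (by omega)) (hE.cubic_pred m)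
      (hE.cubic_succ (m + 1))
  have right : QCommute (1 : K) (E (m + 1)) (rootVector q E m j) := by
    rcases eq_or_lt_of_le (show m + 3 ≤ j by omega) with rfl | h
    · exact base
    · rw [hE.bracket_rootVector (show m < m + 3 by omega) h]
      have h1 : QCommute (1 : K) (E (m + 1)) (rootVector q E (m + 3) j) := by
        rw [qCommute_one_iff]
        exact commute_rootVector q E _ h fun k _ _ => hE.comm_symm (by omega)
      simpa using base.bracket_right (q := q) h1
  rw [← qCommute_one_iff (K := K)]
  rcases eq_or_lt_of_le (Nat.le_of_lt_succ him) with rfl | h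
  · exact right
  · rw [hE.bracket_rootVector h (show m < j by omega)]
    have h1 : QCommute (1 : K) (E (m + 1)) (rootVector q E i m) := by
      rw [qCommute_one_iff]
      exact commute_rootVector q E _ h fun k _ _ => hE.comm_symm (by omega)
    simpa using h1.bracket_right (q := q) right

/-- The Jimbo relation for `i < m < n < j`. -/
theorem SerreRelations.commute_of_nested {i j m n : ℕ} (him : i < m) (hmn : m < n) (hnj : n < j) :
    rootVector q E m n * rootVector q E i j = rootVector q E i j * rootVector q E m n :=
  (commute_rootVector q E _ hmn fun _ _ _ =>
    (hE.middle_commute hq0 hp hp2 (by omega) (by omega)).symm).symm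

/-- The Jimbo relation for `i < j < n` and the pairs `(i, j)`, `(i, n)`. -/
theorem SerreRelations.qCommute_of_same_left {i j n : ℕ} (hij : i < j) (hjn : j < n) :
    QCommute p⁻¹ (rootVector q E i n) (rootVector q E i j) := by
  have h0 := hE.first_qCommute hq0 hp (show i + 1 < n by omega)
  rcases eq_or_lt_of_le (show i + 1 ≤ j from hij) with rfl | h
  · rwa [rootVector_simple]
  · rw [hE.bracket_rootVector (Nat.lt_succ_self i) h, rootVector_simple]
    simpa using h0.bracket_right (q := q)
      (qCommute_one_iff.2 (hE.commute_of_nested hq0 hp hp2 (Nat.lt_succ_self i) h hjn).symm)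

/-- The Jimbo relation for `i < m < j` and the pairs `(i, j)`, `(m, j)`. -/
theorem SerreRelations.qCommute_of_same_right {i j m : ℕ} (him : i < m) (hmj : m < j) :
    QCommute p⁻¹ (rootVector q E m j) (rootVector q E i j) := by
  obtain ⟨j, rfl⟩ : ∃ k, j = k + 1 := ⟨j - 1, by omega⟩
  have h0 := hE.last_qCommute hq0 hp (show i < j by omega)
  rcases eq_or_lt_of_le (Nat.le_of_lt_succ hmj) with rfl | h
  · rwa [rootVector_simple]
  · rw [rootVector_succ q E h]
    simpa using (qCommute_one_iff.2 (hE.commute_of_nested hq0 hp hp2 him h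
      (Nat.lt_succ_self j))).bracket_left (q := q) h0

omit hp2 in
/-- The Jimbo relation for `i < j < n` and the pairs `(i, j)`, `(j, n)`. -/
theorem SerreRelations.mul_of_adjacent {i j n : ℕ} (hij : i < j) (hjn : j < n) :
    rootVector q E j n * rootVector q E i j
      = p • (rootVector q E i j * rootVector q E j n) - q • rootVector q E i n := by
  rw [hE.bracket_rootVector hij hjn, qBracket, hp]
  match_scalars <;> field_simp <;> ring

/-- The Jimbo relation for `i < m < j < n`. -/
theorem SerreRelations.mul_of_overlap {i j m n : ℕ} (him : i < m) (hmj : m < j) (hjn : j < n) :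
    rootVector q E m n * rootVector q E i j = rootVector q E i j * rootVector q E m n
      - (p - p⁻¹) • (rootVector q E i n * rootVector q E m j) := by
  have h3 : rootVector q E m j * rootVector q E i j
      = p⁻¹ • (rootVector q E i j * rootVector q E m j) :=
    hE.qCommute_of_same_right hq0 hp hp2 him hmj
  have h5 := hE.mul_of_adjacent hq0 hp (him.trans hmj) hjn
  have h2 := hE.commute_of_nested hq0 hp hp2 him hmj hjn
  have h3x : ∀ x, rootVector q E m j * (rootVector q E i j * x)
      = p⁻¹ • (rootVector q E i j * (rootVector q E m j * x)) := fun x => by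
    rw [← mul_assoc, h3, smul_mul_assoc, mul_assoc]
  have h5x : ∀ x, rootVector q E j n * (rootVector q E i j * x)
      = p • (rootVector q E i j * (rootVector q E j n * x)) - q • (rootVector q E i n * x) :=
    fun x => by rw [← mul_assoc, h5, sub_mul, smul_mul_assoc, smul_mul_assoc, mul_assoc]
  -- Cutting x_{mn} at j leaves only known pairs: (m, j) and (j, n) against (i, j), and (m, j)
  -- nested in (i, n).
  rw [hE.bracket_rootVector hmj hjn]
  simp only [qBracket, mul_sub, sub_mul, mul_smul_comm, smul_mul_assoc, mul_assoc, h5, h3, h3x,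
    h5x, h2, smul_sub, hp]
  match_scalars <;> field_simp <;> ring

end Jimbo

end RootVectors

/-! ### Adding q-commuting elements to a Serre family -/

section SerreSum

variable {K A : Type*} [Field K] [Ring A] [Algebra K A]

/-- The Cartan matrix of type `A`, with rows and columns indexed by the natural numbers. -/
def cartanNat (i j : ℕ) : ℤ := if i = j then 2 else if i + 1 = j ∨ j + 1 = i then -1 else 0

/-- After t is moved to the right, the terms linear and quadratic in t cancel separately. -/
theorem cubicSerre_add_left {p : K} (hp0 : p ≠ 0) {a b t : A} (h : cubicSerre p a b = 0)
    (ha : QCommute (p ^ 2) t a) (hb : QCommute p⁻¹ t b) : cubicSerre p (a + t) b = 0 := by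
  unfold QCommute at ha hb
  have hax : ∀ x, t * (a * x) = p ^ 2 • (a * (t * x)) := fun x => by
    rw [← mul_assoc, ha, smul_mul_assoc, mul_assoc]
  have hbx : ∀ x, t * (b * x) = p⁻¹ • (b * (t * x)) := fun x => by
    rw [← mul_assoc, hb, smul_mul_assoc, mul_assoc]
  have key : cubicSerre p (a + t) b = cubicSerre p a b := by
    simp only [cubicSerre, mul_add, add_mul, ha, hb, hax, hbx, mul_smul_comm]
    match_scalars <;> field_simp <;> ring
  rw [key, h]

theorem cubicSerre_add_right {p : K} (hp0 : p ≠ 0) {a b t : A} (h : cubicSerre p b a = 0)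
    (hb : QCommute p⁻¹ t b) : cubicSerre p b (a + t) = 0 := by
  unfold QCommute at hb
  have hbx : ∀ x, t * (b * x) = p⁻¹ • (b * (t * x)) := fun x => by
    rw [← mul_assoc, hb, smul_mul_assoc, mul_assoc]
  have key : cubicSerre p b (a + t) = cubicSerre p b a := by
    simp only [cubicSerre, mul_add, add_mul, hb, hbx, mul_smul_comm]
    match_scalars <;> field_simp <;> ring
  rw [key, h]

theorem QCommute.add_right {s : K} {z a b : A} (ha : QCommute s z a) (hb : QCommute s z b) :
    QCommute s z (a + b) := by
  unfold QCommute at *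
  rw [mul_add, ha, hb, add_mul, smul_add]

/-- The scalar p is exactly the one for which the bracket of T with e vanishes. With p⁻¹ the bracket
leaves a multiple of T t, which is nonzero as soon as c and p - p⁻¹ are. -/
theorem qBracket_smul_add {p q c : K} (hq0 : q ≠ 0) (hp : p = q ^ 2) {T e t : A}
    (he : QCommute p e T) (ht : QCommute p⁻¹ t T) :
    qBracket q (c • T) (e + t) = (c * (q⁻¹ * (p - p⁻¹))) • (T * t) := by
  unfold QCommute at he ht
  simp only [qBracket, mul_add, add_mul, smul_mul_assoc, mul_smul_comm, he, ht, hp]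
  match_scalars <;> field_simp <;> ring

/-- Adding elements that commute suitably with a family satisfying the Serre relations and with
each other preserves the Serre relations. -/
theorem SerreRelations.add {p : K} (hp0 : p ≠ 0) {e t : ℕ → A} (he : SerreRelations p e)
    (hte : ∀ k j, QCommute (p ^ cartanNat k j) (t k) (e j))
    (htt : ∀ k j, j < k → QCommute (p ^ cartanNat k j) (t k) (t j)) :
    SerreRelations p (fun i => e i + t i) := by
  have h2 : ∀ i, QCommute (p ^ 2) (t i) (e i) := fun i => by simpa [cartanNat] using hte i i
  have h3 : ∀ i, QCommute p⁻¹ (t i) (e (i + 1)) := fun i => by simpa [cartanNat] using hte i (i + 1)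
  have h4 : ∀ i, QCommute p⁻¹ (t (i + 1)) (e i) := fun i => by simpa [cartanNat] using hte (i + 1) i
  have h5 : ∀ i, QCommute p⁻¹ (t (i + 1)) (t i) := fun i => by
    simpa [cartanNat] using htt (i + 1) i (Nat.lt_succ_self i)
  refine ⟨fun i j hij => ?_, fun i => ?_, fun i => ?_⟩
  · have hte' : ∀ k l, k + 1 < l ∨ l + 1 < k → t k * e l = e l * t k := fun k l h => by
      rw [← qCommute_one_iff (K := K)]
      have := hte k l
      rwa [cartanNat, if_neg (by omega), if_neg (by omega), zpow_zero] at this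
    have htt' : t j * t i = t i * t j := by
      rw [← qCommute_one_iff (K := K)]
      have := htt j i (by omega)
      rwa [cartanNat, if_neg (by omega), if_neg (by omega), zpow_zero] at this
    simp only [mul_add, add_mul, he.comm i j hij, hte' i j (Or.inl hij),
      hte' j i (Or.inr hij), htt']
    abel
  -- In both cubic relations t (i + 1) is added last, because the variables are only assumed to
  -- commute with the larger index moving past the smaller.
  · exact cubicSerre_add_right hp0 (cubicSerre_add_left hp0 (he.cubic_succ i) (h2 i) (h3 i))
      ((h4 i).add_right (h5 i))
  · exact cubicSerre_add_left hp0 (cubicSerre_add_right hp0 (he.cubic_pred i) (h3 i)) (h2 _)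
      ((h4 i).add_right (h5 i))

end SerreSum

/-! ### Weighted shift operators -/

section ShiftOperators

variable {K W : Type*} [Field K] [AddCommGroup W] [Module K W]

/-- The additive extension of `c : ℕ → ℤ` to exponent vectors. -/
def weightPairing (c : ℕ → ℤ) : (ℕ →₀ ℕ) →ₗ[ℕ] ℤ := Finsupp.linearCombination ℕ c

@[simp]
theorem weightPairing_single (c : ℕ → ℤ) (k : ℕ) : weightPairing c (Finsupp.single k 1) = c k := by
  simp [weightPairing]

theorem weightPairing_add (c d : ℕ → ℤ) (u : ℕ →₀ ℕ) :
    weightPairing (c + d) u = weightPairing c u + weightPairing d u := by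
  simp [weightPairing, Finsupp.linearCombination_apply, Finsupp.sum, mul_add,
    Finset.sum_add_distrib]

/-- The operator sending `w` in degree `u` to `p ^ ⟨c, u⟩ g w` in degree `u + s`. -/
def shiftOp (p : K) (c : ℕ → ℤ) (s : ℕ →₀ ℕ) (g : Module.End K W) :
    Module.End K ((ℕ →₀ ℕ) →₀ W) :=
  Finsupp.lsum K fun u => p ^ weightPairing c u • (Finsupp.lsingle (u + s) ∘ₗ g)

@[simp]
theorem shiftOp_single (p : K) (c : ℕ → ℤ) (s : ℕ →₀ ℕ) (g : Module.End K W) (u : ℕ →₀ ℕ) (w : W) :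
    shiftOp p c s g (Finsupp.single u w)
      = Finsupp.single (u + s) (p ^ weightPairing c u • g w) := by
  simp [shiftOp]

theorem shiftOp_mul {p : K} (hp0 : p ≠ 0) (c d : ℕ → ℤ) (s t : ℕ →₀ ℕ) (g h : Module.End K W) :
    shiftOp p c s g * shiftOp p d t h
      = p ^ weightPairing c t • shiftOp p (c + d) (s + t) (g * h) := by
  refine Finsupp.lhom_ext fun u w => ?_
  simp only [Module.End.mul_apply, shiftOp_single, map_add, zpow_add₀ hp0, map_smul,
    LinearMap.smul_apply, Finsupp.smul_single, weightPairing_add, smul_smul]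
  congr 1
  · abel
  · congr 1; ring

/-- In a product, the left factor sees the degree already shifted by the right one. The commutation
scalar is therefore governed by the weights and shifts alone, and any required exponent can be
arranged. -/
theorem shiftOp_qCommute {p : K} (hp0 : p ≠ 0) (c d : ℕ → ℤ) (s t : ℕ →₀ ℕ) (g h : Module.End K W)
    (hgh : g * h = h * g) :
    QCommute (p ^ (weightPairing c t - weightPairing d s)) (shiftOp p c s g) (shiftOp p d t h) := by
  rw [QCommute, shiftOp_mul hp0, shiftOp_mul hp0, smul_smul, ← zpow_add₀ hp0, sub_add_cancel,
    add_comm c, add_comm s, hgh]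

theorem shiftOp_zero (p : K) (c : ℕ → ℤ) (s : ℕ →₀ ℕ) : shiftOp p c s (0 : Module.End K W) = 0 := by
  refine Finsupp.lhom_ext fun u w => ?_
  simp

theorem shiftOp_apply_add (p : K) (c : ℕ → ℤ) (s : ℕ →₀ ℕ) (g : Module.End K W)
    (v : (ℕ →₀ ℕ) →₀ W) (u : ℕ →₀ ℕ) :
    shiftOp p c s g v (u + s) = p ^ weightPairing c u • g (v u) := by
  classical
  induction v using Finsupp.induction_linear with
  | zero => simp
  | add f g hf hg => simp [hf, hg]
  | single a w =>
    rw [shiftOp_single, Finsupp.single_apply, Finsupp.single_apply]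
    by_cases h : a = u
    · simp [h]
    · simp [h]

/-- Every degree in the image has the form a + s, and its total degree exceeds that of s unless a =
0. Thus s is the lowest degree that can occur. -/
theorem shiftOp_apply_eq_zero (p : K) (c : ℕ → ℤ) (s : ℕ →₀ ℕ) (g : Module.End K W)
    (v : (ℕ →₀ ℕ) →₀ W) {u : ℕ →₀ ℕ} (hu : u ≠ s) (hd : u.degree ≤ s.degree) :
    shiftOp p c s g v u = 0 := by
  classical
  induction v using Finsupp.induction_linear with
  | zero => simp
  | add f g hf hg => simp [hf, hg]
  | single a w =>
    rw [shiftOp_single, Finsupp.single_apply, if_neg]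
    rintro rfl
    rw [map_add] at hd
    have : a = 0 := by
      rw [← Finsupp.degree_eq_zero_iff]
      omega
    exact hu (by simp [this])

/-- The degree-preserving lift of a Serre family. -/
def liftOp (p : K) (E : ℕ → Module.End K W) (j : ℕ) : Module.End K ((ℕ →₀ ℕ) →₀ W) :=
  shiftOp p (fun l => -cartanNat l j) 0 (E j)

/-- The twisted multiplication by the `k`-th variable, for `r ≤ k < N`. -/
def varOp (W : Type*) [AddCommGroup W] [Module K W] (p : K) (r N k : ℕ) :
    Module.End K ((ℕ →₀ ℕ) →₀ W) :=
  if r ≤ k ∧ k < N then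
    shiftOp p (fun l => if l < k then cartanNat k l else 0) (Finsupp.single k 1) 1
  else 0

/-- The Serre family obtained by adding to `E` the variables numbered from `r` to `N - 1`. -/
def extendOp (p : K) (r N : ℕ) (E : ℕ → Module.End K W) (k : ℕ) :
    Module.End K ((ℕ →₀ ℕ) →₀ W) :=
  liftOp p E k + varOp W p r N k

theorem cubicSerre_shiftOp {p : K} (hp0 : p ≠ 0) (c d : ℕ → ℤ) (g h : Module.End K W) :
    cubicSerre p (shiftOp p c 0 g) (shiftOp p d 0 h)
      = shiftOp p (c + (c + d)) 0 (cubicSerre p g h) := by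
  have h1 : c + (d + c) = c + (c + d) := by rw [add_comm d]
  have h2 : d + (c + c) = c + (c + d) := by rw [add_comm d, add_assoc]
  simp only [cubicSerre, shiftOp_mul hp0, map_zero, zpow_zero, one_smul, add_zero, h1, h2]
  refine Finsupp.lhom_ext fun u w => ?_
  simp only [LinearMap.add_apply, LinearMap.sub_apply, LinearMap.smul_apply, shiftOp_single,
    Finsupp.smul_single, ← Finsupp.single_add, ← Finsupp.single_sub]
  congr 1
  module

theorem serreRelations_liftOp {p : K} (hp0 : p ≠ 0) {E : ℕ → Module.End K W}
    (hE : SerreRelations p E) : SerreRelations p (liftOp p E) := by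
  refine ⟨fun i j hij => ?_, fun i => ?_, fun i => ?_⟩
  · rw [← qCommute_one_iff (K := K)]
    simpa [liftOp] using shiftOp_qCommute hp0 (fun l => -cartanNat l i) (fun l => -cartanNat l j)
      0 0 (E i)
      (E j) (hE.comm i j hij)
  · rw [liftOp, liftOp, cubicSerre_shiftOp hp0, hE.cubic_succ, shiftOp_zero]
  · rw [liftOp, liftOp, cubicSerre_shiftOp hp0, hE.cubic_pred, shiftOp_zero]

/-- The weights are tuned for `SerreRelations.add`: the lifted E j carries the weight -a_{kj}
against the variable k, and of two variables only the one with the larger index carries a weight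
against the other. -/
theorem serreRelations_extendOp {p : K} (hp0 : p ≠ 0) (r N : ℕ) {E : ℕ → Module.End K W}
    (hE : SerreRelations p E) : SerreRelations p (extendOp p r N E) := by
  refine (serreRelations_liftOp hp0 hE).add hp0 (fun k j => ?_) (fun k j hjk => ?_)
  · rw [varOp]
    split_ifs
    · simpa [liftOp] using shiftOp_qCommute hp0 (fun l => if l < k then cartanNat k l else 0)
        (fun l => -cartanNat l j) (Finsupp.single k 1) 0 1 (E j) (by simp)
    · exact qCommute_zero_left _ _
  · rw [varOp, varOp]
    split_ifs
    · simpa [hjk, hjk.not_gt] using shiftOp_qCommute hp0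
        (fun l => if l < k then cartanNat k l else 0)
        (fun l => if l < j then cartanNat j l else 0) (Finsupp.single k 1) (Finsupp.single j 1)
        (1 : Module.End K W) 1 rfl
    · exact qCommute_zero_right _ _
    · exact qCommute_zero_left _ _
    · exact qCommute_zero_left _ _

/-- The lifted operators preserve the degree and the variables raise it, so taking the constant term
intertwines the new family with the old one. -/
theorem extendOp_apply_zero (p : K) (r N : ℕ) (E : ℕ → Module.End K W) (k : ℕ)
    (v : (ℕ →₀ ℕ) →₀ W) : extendOp p r N E k v 0 = E k (v 0) := by
  have h1 : liftOp p E k v 0 = E k (v 0) := by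
    simpa [liftOp] using shiftOp_apply_add p (fun l => -cartanNat l k) 0 (E k) v 0
  have h2 : varOp W p r N k v 0 = 0 := by
    rw [varOp]
    split_ifs
    · exact shiftOp_apply_eq_zero _ _ _ _ _ (by simp [eq_comm]) (by simp)
    · simp
  simp [extendOp, h1, h2]

/-- The exponent vector with entries `1` at `i, …, j - 1`. -/
def segmentVector (i j : ℕ) : ℕ →₀ ℕ := ∑ k ∈ Finset.Ico i j, Finsupp.single k 1

theorem weightPairing_segmentVector (c : ℕ → ℤ) (i j : ℕ) :
    weightPairing c (segmentVector i j) = ∑ k ∈ Finset.Ico i j, c k := by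
  simp [segmentVector]

theorem segmentVector_apply (i j k : ℕ) : segmentVector i j k = if i ≤ k ∧ k < j then 1 else 0 := by
  classical
  simp [segmentVector, Finsupp.finsetSum_apply, Finsupp.single_apply]

theorem sum_cartanNat_right {r j : ℕ} (h : r < j) : ∑ k ∈ Finset.Ico r j, cartanNat k j = -1 := by
  obtain ⟨j, rfl⟩ : ∃ k, j = k + 1 := ⟨j - 1, by omega⟩
  rw [Finset.sum_Ico_succ_top (by omega), Finset.sum_eq_zero]
  · simp [cartanNat]
  · intro k hk
    rw [Finset.mem_Ico] at hk
    rw [cartanNat, if_neg (by omega), if_neg (by omega)]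

theorem cartanNat_comm (i j : ℕ) : cartanNat i j = cartanNat j i := by
  unfold cartanNat
  simp only [eq_comm (a := i) (b := j), or_comm]

/-- The root vectors of the first row of the extended family are monomials in the variables. -/
theorem rootVector_extendOp {p q : K} (hq0 : q ≠ 0) (hp : p = q ^ 2) (hp1 : p - p⁻¹ ≠ 0) {r N : ℕ}
    {E : ℕ → Module.End K W} (hEr : E r = 0) {j : ℕ} (hrj : r < j) (hjN : j ≤ N) :
    ∃ (c : K) (γ : ℕ → ℤ), c ≠ 0 ∧ (∀ l, j ≤ l → γ l = 0) ∧
      rootVector q (extendOp p r N E) r j = c • shiftOp p γ (segmentVector r j) 1 := by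
  have hp0 : p ≠ 0 := hp ▸ pow_ne_zero 2 hq0
  induction j, hrj using Nat.le_induction with
  | base =>
    refine ⟨1, fun l => if l < r then cartanNat r l else 0, one_ne_zero, fun l hl => ?_, ?_⟩
    · exact if_neg (by omega)
    -- Since E r = 0, the first root vector of the row is the bare variable.
    · rw [rootVector_simple, extendOp, liftOp, hEr, shiftOp_zero, varOp,
        if_pos ⟨le_rfl, by omega⟩, zero_add, one_smul, segmentVector]
      simp
  | succ j hj ih =>
    obtain ⟨c, γ, hc, hγ, ih⟩ := ih (by omega)
    have hrj : r < j := hj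
    set T : Module.End K ((ℕ →₀ ℕ) →₀ W) := shiftOp p γ (segmentVector r j) 1 with hT
    let d : ℕ → ℤ := fun l => if l < j then cartanNat j l else 0
    -- Column j of the Cartan matrix sums to -1 over r, …, j - 1. So the lifted E j and the variable
    -- j pass T with the opposite scalars p and p⁻¹, the second because γ vanishes at j. The bracket
    -- then kills the first and keeps the second.
    have he : QCommute p (liftOp p E j) T := by
      have := shiftOp_qCommute hp0 (fun l => -cartanNat l j) γ 0 (segmentVector r j) (E j) 1
        (by simp)
      simpa [liftOp, hT, weightPairing_segmentVector, sum_cartanNat_right hrj] using this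
    have ht : QCommute p⁻¹ (shiftOp p d (Finsupp.single j 1) 1) T := by
      have := shiftOp_qCommute hp0 d γ (Finsupp.single j 1) (segmentVector r j)
        (1 : Module.End K W) 1 rfl
      rw [weightPairing_segmentVector, Finset.sum_congr rfl (g := fun k => cartanNat k j),
        sum_cartanNat_right hrj, weightPairing_single, hγ j le_rfl] at this
      · simpa using this
      · intro k hk
        rw [Finset.mem_Ico] at hk
        simp only [d, if_pos hk.2, cartanNat_comm]
    have hprod : T * shiftOp p d (Finsupp.single j 1) 1
        = shiftOp p (γ + d) (segmentVector r (j + 1)) 1 := by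
      rw [hT, shiftOp_mul hp0, weightPairing_single, hγ j le_rfl, zpow_zero, one_smul, one_mul,
        segmentVector, segmentVector, Finset.sum_Ico_succ_top hrj.le]
    refine ⟨c * (q⁻¹ * (p - p⁻¹)), γ + d, mul_ne_zero hc (mul_ne_zero (inv_ne_zero hq0) hp1),
      fun l hl => ?_, ?_⟩
    · simp only [Pi.add_apply, hγ l (by omega), d, if_neg (show ¬ l < j by omega), add_zero]
    · rw [rootVector_succ q _ hrj, ih, extendOp, varOp, if_pos ⟨hrj.le, by omega⟩, ← hprod]
      exact qBracket_smul_add hq0 hp he ht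

end ShiftOperators

/-! ### Linear independence of the ordered monomials -/

section OrderedMonomials

/-- Triangularity: in a vanishing combination, take an index i of the support with `deg (s i)`
minimal. At the position `s i` only the indices with the same value of `s` contribute, and these
components are independent. -/
theorem LinearIndependent.of_leading_component {K ι U W : Type*} [Field K] [AddCommGroup W]
    [Module K W] (deg : U → ℕ) (s : ι → U) (f : ι → U →₀ W)
    (h0 : ∀ i u, u ≠ s i → deg u ≤ deg (s i) → f i u = 0)
    (hli : ∀ u, LinearIndependent K (fun i : {i // s i = u} => f i u)) :
    LinearIndependent K f := by
  classical
  rw [linearIndependent_iff]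
  intro l hl
  by_contra hne
  obtain ⟨i, hi, hmin⟩ := Finset.exists_min_image l.support (fun i => deg (s i))
    (Finsupp.support_nonempty_iff.2 hne)
  have h1 : (l.subtypeDomain fun j => s j = s i) = 0 := by
    refine linearIndependent_iff.1 (hli (s i)) _ ?_
    have h2 := DFunLike.congr_fun hl (s i)
    rw [Finsupp.linearCombination_apply, Finsupp.sum, Finsupp.finsetSum_apply] at h2
    rw [Finsupp.linearCombination_apply, Finsupp.sum, Finsupp.support_subtypeDomain]
    simp only [Finsupp.subtypeDomain_apply]
    rw [Finset.sum_subtype_eq_sum_filter (s := l.support) (p := fun j => s j = s i)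
        (f := fun j => l j • f j (s i)), Finset.sum_filter]
    refine Eq.trans (Finset.sum_congr rfl fun j hj => ?_) h2
    split_ifs with h
    · rfl
    · rw [Finsupp.smul_apply, h0 j (s i) (Ne.symm h) (hmin j hj), smul_zero]
  exact Finsupp.mem_support_iff.1 hi (DFunLike.congr_fun h1 ⟨i, rfl⟩)

theorem lexLT_iff {N : ℕ} {a b : RootIndex N} : LexLT a b ↔ toLex a.1 < toLex b.1 :=
  (Prod.Lex.lt_iff (x := toLex a.1) (y := toLex b.1)).symm

/-- The words that are weakly increasing for the lexicographic ordering of the letters. -/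
def IsOrderedWord {N : ℕ} (w : List (RootIndex N)) : Prop :=
  w.Pairwise fun a b => ¬ LexLT b a

/-- The product of root vectors along a word. -/
def wordProd {K A : Type*} [Field K] [Ring A] [Algebra K A] {N : ℕ} (q : K) (E : ℕ → A)
    (w : List (RootIndex N)) : A :=
  (w.map fun a => rootVector q E a.1.1 a.1.2).prod

theorem eq_of_not_lexLT {N : ℕ} {a b : RootIndex N} (h1 : ¬ LexLT a b) (h2 : ¬ LexLT b a) :
    a = b := by
  rw [lexLT_iff, not_lt] at h1 h2
  exact Subtype.ext (toLex.injective (le_antisymm h2 h1))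

/-- The lexicographic ordering compares rows first, so the letters of the lowest row form an initial
segment. -/
theorem IsOrderedWord.eq_append {N : ℕ} (r : ℕ) {w : List (RootIndex N)} (hw : IsOrderedWord w)
    (hr : ∀ a ∈ w, r ≤ a.1.1) :
    w = w.filter (fun a => a.1.1 = r) ++ w.filter (fun a => r < a.1.1) := by
  induction w with
  | nil => rfl
  | cons a w ih =>
    have hw' := List.pairwise_cons.1 hw
    have ih := ih hw'.2 fun b hb => hr b (List.mem_cons_of_mem _ hb)
    rcases (hr a List.mem_cons_self).eq_or_lt with h | h
    · simpa [← h] using ih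
    · have h1 : w.filter (fun b => b.1.1 = r) = [] := by
        rw [List.filter_eq_nil_iff]
        intro b hb hbr
        refine hw'.1 b hb (Or.inl ?_)
        rw [Fin.lt_def]
        simp only [decide_eq_true_eq] at hbr
        omega
      rw [h1] at ih
      simpa [h, h.ne', h1] using ih

/-- The multidegree of a word in the letters of one row. -/
def wordShift {N : ℕ} (r : ℕ) (w : List (RootIndex N)) : ℕ →₀ ℕ :=
  (w.map fun a => segmentVector r a.1.2).sum

/-- The letter (r, k + 1) is the only one of row r whose segment contains k but not k + 1. Hence the
multiplicities of the letters, and with them an ordered word of row r, can be read off from the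
multidegree. -/
theorem count_add_wordShift {N : ℕ} {r : ℕ} {w : List (RootIndex N)} (hw : ∀ a ∈ w, a.1.1 = r)
    (a : RootIndex N) (ha : a.1.1 = r) (k : ℕ) (hk : a.1.2 = k + 1) :
    wordShift r w k = w.count a + wordShift r w (k + 1) := by
  induction w with
  | nil => simp [wordShift]
  | cons b w ih =>
    have ih := ih fun c hc => hw c (List.mem_cons_of_mem _ hc)
    have hb := hw b List.mem_cons_self
    have hlt : (a.1.1 : ℕ) < a.1.2 := a.2
    have hab : b = a ↔ (b.1.2 : ℕ) = k + 1 := by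
      constructor
      · rintro rfl
        exact hk
      · intro h
        exact Subtype.ext (Prod.ext (Fin.ext (hb.trans ha.symm)) (Fin.ext (h.trans hk.symm)))
    simp only [wordShift, List.map_cons, List.sum_cons, Finsupp.add_apply, segmentVector_apply,
      List.count_cons, beq_iff_eq, hab] at ih ⊢
    rw [ih]
    split_ifs <;> omega

theorem eq_of_wordShift_eq {N : ℕ} {r : ℕ} {w w' : List (RootIndex N)} (hw : ∀ a ∈ w, a.1.1 = r)
    (hw' : ∀ a ∈ w', a.1.1 = r) (ho : IsOrderedWord w) (ho' : IsOrderedWord w')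
    (h : wordShift r w = wordShift r w') : w = w' := by
  have hperm : w.Perm w' := by
    rw [List.perm_iff_count]
    intro a
    by_cases ha : a.1.1 = r
    · have hlt : (a.1.1 : ℕ) < a.1.2 := a.2
      obtain ⟨k, hk⟩ : ∃ k, (a.1.2 : ℕ) = k + 1 := ⟨a.1.2 - 1, by omega⟩
      have h1 := count_add_wordShift hw a ha k hk
      have h2 := count_add_wordShift hw' a ha k hk
      rw [h] at h1
      omega
    · rw [List.count_eq_zero.2 fun hm => ha (hw a hm), List.count_eq_zero.2 fun hm => ha (hw' a hm)]
  exact hperm.eq_of_pairwise (fun a b _ _ h1 h2 => eq_of_not_lexLT h2 h1) ho ho'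

theorem wordProd_map {K A B : Type*} [Field K] [Ring A] [Algebra K A] [Ring B] [Algebra K B]
    (φ : A →ₐ[K] B) {N : ℕ} (q : K) (E : ℕ → A) (w : List (RootIndex N)) :
    φ (wordProd q E w) = wordProd q (fun k => φ (E k)) w := by
  simp [wordProd, map_list_prod, Function.comp_def, rootVector_map]

section

variable {K V W : Type*} [Field K] [AddCommGroup V] [Module K V] [AddCommGroup W] [Module K W]

theorem intertwine_rootVector (q : K) {D : ℕ → Module.End K V} {E : ℕ → Module.End K W}
    (ε : V →ₗ[K] W) (h : ∀ k v, ε (D k v) = E k (ε v)) (i j : ℕ) (v : V) :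
    ε (rootVector q D i j v) = rootVector q E i j (ε v) := by
  induction j generalizing v with
  | zero => simp [rootVector]
  | succ j ih =>
    rw [rootVector, rootVector]
    split_ifs
    · exact h i v
    · simp [qBracket, ih, h]

theorem intertwine_wordProd (q : K) {D : ℕ → Module.End K V} {E : ℕ → Module.End K W}
    (ε : V →ₗ[K] W) (h : ∀ k v, ε (D k v) = E k (ε v)) {N : ℕ} (w : List (RootIndex N)) (v : V) :
    ε (wordProd q D w v) = wordProd q E w (ε v) := by
  induction w generalizing v with
  | nil => simp [wordProd]
  | cons a w ih =>
    simp only [wordProd, List.map_cons, List.prod_cons, Module.End.mul_apply] at ih ⊢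
    rw [intertwine_rootVector q ε h, ih]

theorem wordProd_extendOp {p q : K} (hq0 : q ≠ 0) (hp : p = q ^ 2) (hp1 : p - p⁻¹ ≠ 0) {r N : ℕ}
    {E : ℕ → Module.End K W} (hEr : E r = 0) (w : List (RootIndex N)) (hw : ∀ a ∈ w, a.1.1 = r) :
    ∃ (c : K) (γ : ℕ → ℤ), c ≠ 0 ∧
      wordProd q (extendOp p r N E) w = c • shiftOp p γ (wordShift r w) 1 := by
  have hp0 : p ≠ 0 := hp ▸ pow_ne_zero 2 hq0
  induction w with
  | nil =>
    refine ⟨1, 0, one_ne_zero, ?_⟩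
    refine Finsupp.lhom_ext fun u v => ?_
    simp [wordProd, wordShift, weightPairing]
  | cons a w ih =>
    obtain ⟨c, γ, hc, ih⟩ := ih fun b hb => hw b (List.mem_cons_of_mem _ hb)
    have ha : (a.1.1 : ℕ) = r := hw a List.mem_cons_self
    have hlt : (a.1.1 : ℕ) < a.1.2 := a.2
    obtain ⟨d, δ, hd, -, hx⟩ := rootVector_extendOp hq0 hp hp1 (N := N) (E := E) hEr
      (show r < a.1.2 by omega) (by omega)
    refine ⟨d * c * p ^ weightPairing δ (wordShift r w), δ + γ,
      mul_ne_zero (mul_ne_zero hd hc) (zpow_ne_zero _ hp0), ?_⟩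
    rw [wordProd] at ih
    rw [wordProd, List.map_cons, List.prod_cons, ha, hx, ih, smul_mul_smul_comm, shiftOp_mul hp0,
      smul_smul, mul_one, wordShift, wordShift, List.map_cons, List.sum_cons]

end

/-- Downward induction on r, one row of letters being added at each stage. The vanishing of E k for
k < r is part of the induction because the next stage needs E r = 0 to turn the new row into
monomials. -/
theorem exists_linearIndependent_wordProd.{u} {K : Type u} [Field K] {p q : K} (hq0 : q ≠ 0)
    (hp : p = q ^ 2) (hp1 : p - p⁻¹ ≠ 0) (N r : ℕ) (hr : r ≤ N) :
    ∃ (W : Type u) (_ : AddCommGroup W) (_ : Module K W) (E : ℕ → Module.End K W) (w₀ : W),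
      SerreRelations p E ∧ (∀ k, k < r ∨ N ≤ k → E k = 0) ∧
      LinearIndependent K
        fun w : {w : List (RootIndex N) // IsOrderedWord w ∧ ∀ a ∈ w, r ≤ a.1.1} =>
          wordProd q E w.1 w₀ := by
  have hp0 : p ≠ 0 := hp ▸ pow_ne_zero 2 hq0
  induction hr using Nat.decreasingInduction with
  | self =>
    -- No letter has a row ≥ N, so the empty word is the only one.
    refine ⟨K, inferInstance, inferInstance, 0, 1, ?_, fun _ _ => rfl, ?_⟩
    · constructor <;> simp [cubicSerre]
    · have hnil : ∀ w : {w : List (RootIndex N) // IsOrderedWord w ∧ ∀ a ∈ w, N ≤ a.1.1},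
          w.1 = [] := fun w => List.eq_nil_iff_forall_not_mem.2 fun a ha => by
        have h1 := w.2.2 a ha
        have h2 : (a.1.1 : ℕ) < a.1.2 := a.2
        omega
      have : Subsingleton {w : List (RootIndex N) // IsOrderedWord w ∧ ∀ a ∈ w, N ≤ a.1.1} :=
        ⟨fun v w => Subtype.ext ((hnil v).trans (hnil w).symm)⟩
      refine LinearIndependent.of_subsingleton ⟨[], List.Pairwise.nil, by simp⟩ ?_
      simp [wordProd]
  | of_succ r hr ih =>
    obtain ⟨W, _, _, E, w₀, hE, hE0, hli⟩ := ih
    have hEr : E r = 0 := hE0 r (Or.inl (Nat.lt_succ_self r))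
    refine ⟨(ℕ →₀ ℕ) →₀ W, inferInstance, inferInstance, extendOp p r N E, Finsupp.single 0 w₀,
      serreRelations_extendOp hp0 r N hE, fun k hk => ?_, ?_⟩
    · rw [extendOp, liftOp, hE0 k (by omega), shiftOp_zero, varOp, if_neg (by omega), add_zero]
    · have hform : ∀ w : {w : List (RootIndex N) // IsOrderedWord w ∧ ∀ a ∈ w, r ≤ a.1.1},
          ∃ (c : K) (γ : ℕ → ℤ), c ≠ 0 ∧
            wordProd q (extendOp p r N E) w.1 (Finsupp.single 0 w₀)
              = c • shiftOp p γ (wordShift r (w.1.filter fun a => a.1.1 = r)) 1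
                (wordProd q (extendOp p r N E) (w.1.filter fun a => r < a.1.1)
                  (Finsupp.single 0 w₀)) := fun w => by
        obtain ⟨c, γ, hc, h⟩ := wordProd_extendOp hq0 hp hp1 (N := N) hEr
          (w.1.filter fun a => a.1.1 = r) (fun a ha => by simpa using (List.mem_filter.1 ha).2)
        refine ⟨c, γ, hc, ?_⟩
        conv_lhs => rw [w.2.1.eq_append r w.2.2]
        rw [← LinearMap.smul_apply, ← h, ← Module.End.mul_apply]
        simp [wordProd]
      choose c γ hc hform using hform
      -- The lowest term sits at the multidegree of the row r part; its coefficient is, up to a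
      -- nonzero scalar, the vector of the remaining rows in the old representation.
      refine LinearIndependent.of_leading_component (fun u => u.degree)
        (fun w => wordShift r (w.1.filter fun a => a.1.1 = r)) _ (fun w u hu hd => ?_) (fun u => ?_)
      · rw [hform, Finsupp.smul_apply, shiftOp_apply_eq_zero _ _ _ _ _ hu hd, smul_zero]
      · have hval : ∀ w, wordProd q (extendOp p r N E) w.1 (Finsupp.single 0 w₀)
            (wordShift r (w.1.filter fun a => a.1.1 = r))
            = c w • wordProd q E (w.1.filter fun a => r < a.1.1) w₀ := fun w => by
          rw [hform, Finsupp.smul_apply]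
          have h1 := shiftOp_apply_add p (γ w) (wordShift r (w.1.filter fun a => a.1.1 = r)) 1
            (wordProd q (extendOp p r N E) (w.1.filter fun a => r < a.1.1) (Finsupp.single 0 w₀)) 0
          have h2 := intertwine_wordProd q (D := extendOp p r N E) (E := E)
            (Finsupp.lapply (R := K) (M := W) (0 : ℕ →₀ ℕ))
            (fun k v => extendOp_apply_zero p r N E k v) (w.1.filter fun a => r < a.1.1)
            (Finsupp.single 0 w₀)
          rw [Finsupp.lapply_apply] at h2
          rw [zero_add, map_zero, zpow_zero, one_smul, Module.End.one_apply] at h1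
          rw [h1, h2]
          simp
        let tail : {w : {w : List (RootIndex N) // IsOrderedWord w ∧ ∀ a ∈ w, r ≤ a.1.1} //
            wordShift r (w.1.filter fun a => a.1.1 = r) = u} →
            {w : List (RootIndex N) // IsOrderedWord w ∧ ∀ a ∈ w, r + 1 ≤ a.1.1} :=
          fun w => ⟨w.1.1.filter fun a => r < a.1.1, w.1.2.1.filter _,
            fun a ha => by simpa using (List.mem_filter.1 ha).2⟩
        -- Among words with the same multidegree u the row r part is the same, so the rest
        -- determines the word.
        have htail : Function.Injective tail := fun v w h => by
          have h1 : v.1.1.filter (fun a => r < a.1.1) = w.1.1.filter (fun a => r < a.1.1) :=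
            congrArg Subtype.val h
          have h2 : v.1.1.filter (fun a => a.1.1 = r) = w.1.1.filter (fun a => a.1.1 = r) :=
            eq_of_wordShift_eq (fun a ha => by simpa using (List.mem_filter.1 ha).2)
              (fun a ha => by simpa using (List.mem_filter.1 ha).2) (v.1.2.1.filter _)
              (w.1.2.1.filter _) (v.2.trans w.2.symm)
          apply Subtype.ext
          apply Subtype.ext
          rw [v.1.2.1.eq_append r v.1.2.2, w.1.2.1.eq_append r w.1.2.2, h1, h2]
        have := (hli.comp tail htail).units_smul fun w => Units.mk0 (c w.1) (hc w.1)
        convert this using 2 with w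
        obtain ⟨w, rfl⟩ := w
        exact hval w

end OrderedMonomials

/-! ### The algebra defined by the Serre relations, and the action of the quantum group on it -/

section SerreAlgebra

variable {K : Type*} [Field K]

/-- The Serre relations of type `A_∞` in the free algebra. -/
inductive SerreRel (p : K) : FreeAlgebra K ℕ → FreeAlgebra K ℕ → Prop
  | comm (i j : ℕ) (h : i + 1 < j) : SerreRel p
      (FreeAlgebra.ι K i * FreeAlgebra.ι K j) (FreeAlgebra.ι K j * FreeAlgebra.ι K i)
  | cubic_succ (i : ℕ) : SerreRel p
      (cubicSerre p (FreeAlgebra.ι K i) (FreeAlgebra.ι K (i + 1))) 0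
  | cubic_pred (i : ℕ) : SerreRel p
      (cubicSerre p (FreeAlgebra.ι K (i + 1)) (FreeAlgebra.ι K i)) 0

/-- The algebra defined by the Serre relations of type `A_∞`. -/
def SerreAlgebra (p : K) : Type _ := RingQuot (SerreRel p)

instance (p : K) : Ring (SerreAlgebra p) := inferInstanceAs (Ring (RingQuot (SerreRel p)))

instance (p : K) : Algebra K (SerreAlgebra p) :=
  inferInstanceAs (Algebra K (RingQuot (SerreRel p)))

/-- The projection from the free algebra. -/
def serreMk (p : K) : FreeAlgebra K ℕ →ₐ[K] SerreAlgebra p := RingQuot.mkAlgHom K (SerreRel p)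

theorem serreMk_rel {p : K} {a b : FreeAlgebra K ℕ} (h : SerreRel p a b) :
    serreMk p a = serreMk p b := RingQuot.mkAlgHom_rel K h

theorem serreMk_surjective (p : K) : Function.Surjective (serreMk p) :=
  RingQuot.mkAlgHom_surjective K (SerreRel p)

/-- The generators of the Serre algebra. -/
def serreGen (p : K) (k : ℕ) : SerreAlgebra p :=
  serreMk p (FreeAlgebra.ι K k)

theorem map_cubicSerre {A B : Type*} [Ring A] [Algebra K A] [Ring B] [Algebra K B]
    (φ : A →ₐ[K] B) (p : K) (a b : A) : φ (cubicSerre p a b) = cubicSerre p (φ a) (φ b) := by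
  simp [cubicSerre]

theorem serreRelations_serreGen (p : K) : SerreRelations p (serreGen p) := by
  refine ⟨fun i j h => ?_, fun i => ?_, fun i => ?_⟩
  · simpa [serreGen] using serreMk_rel (SerreRel.comm (p := p) i j h)
  · simpa [map_cubicSerre, serreGen] using serreMk_rel (SerreRel.cubic_succ (p := p) i)
  · simpa [map_cubicSerre, serreGen] using serreMk_rel (SerreRel.cubic_pred (p := p) i)

/-- The homomorphism from the Serre algebra given by a family satisfying the Serre relations. -/
def SerreRelations.lift {p : K} {A : Type*} [Ring A] [Algebra K A] {E : ℕ → A}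
    (hE : SerreRelations p E) : SerreAlgebra p →ₐ[K] A :=
  RingQuot.liftAlgHom K ⟨FreeAlgebra.lift K E, fun _ _ h => by
    cases h with
    | comm i j h => simpa using hE.comm i j h
    | cubic_succ i => simpa [map_cubicSerre] using hE.cubic_succ i
    | cubic_pred i => simpa [map_cubicSerre] using hE.cubic_pred i⟩

@[simp]
theorem SerreRelations.lift_serreGen {p : K} {A : Type*} [Ring A] [Algebra K A] {E : ℕ → A}
    (hE : SerreRelations p E) (k : ℕ) : hE.lift (serreGen p k) = E k :=
  (RingQuot.liftAlgHom_mkAlgHom_apply K _ _ _).trans (by simp)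

/-- A linear map on the Serre algebra that kills `1` and commutes up to scalars with the
multiplication by the generators is zero. -/
theorem SerreAlgebra.linearMap_eq_zero {p : K} (Z : Module.End K (SerreAlgebra p)) (h1 : Z 1 = 0)
    (h : ∀ k, ∃ c : K, ∀ r, Z (serreGen p k * r) = c • (serreGen p k * Z r)) : Z = 0 := by
  -- The kernel of Z is stable under left multiplication by the whole algebra, and it contains 1.
  have key : ∀ (f : FreeAlgebra K ℕ) (r : SerreAlgebra p), Z r = 0 →
      Z (serreMk p f * r) = 0 := by
    intro f
    induction f using FreeAlgebra.induction with
    | grade0 c =>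
      intro r hr
      rw [AlgHom.commutes, ← Algebra.smul_def, map_smul, hr, smul_zero]
    | grade1 k =>
      intro r hr
      obtain ⟨c, hc⟩ := h k
      have := hc r
      rw [hr, mul_zero, smul_zero] at this
      exact this
    | mul f g hf hg =>
      intro r hr
      rw [map_mul (serreMk p), mul_assoc]
      exact hf _ (hg _ hr)
    | add f g hf hg =>
      intro r hr
      rw [map_add, add_mul, map_add, hf r hr, hg r hr, add_zero]
  refine LinearMap.ext fun r => ?_
  obtain ⟨f, rfl⟩ := serreMk_surjective p r
  simpa using key f 1 h1

theorem SerreRelations.smul {p : K} {A : Type*} [Ring A] [Algebra K A] {E : ℕ → A}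
    (hE : SerreRelations p E) (c : ℕ → K) : SerreRelations p (fun k => c k • E k) := by
  have hc : ∀ (c d : K) (a b : A), cubicSerre p (c • a) (d • b) = (c * c * d) • cubicSerre p a b :=
    fun c d a b => by
      simp only [cubicSerre, smul_mul_assoc, mul_smul_comm]
      module
  refine ⟨fun i j h => ?_, fun i => ?_, fun i => ?_⟩
  · simp only [smul_mul_assoc, mul_smul_comm, hE.comm i j h, smul_smul, mul_comm]
  · rw [hc, hE.cubic_succ, smul_zero]
  · rw [hc, hE.cubic_pred, smul_zero]

/-- The endomorphism of the Serre algebra that scales the generators by `c`. -/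
def scaleHom (p : K) (c : ℕ → K) : SerreAlgebra p →ₐ[K] SerreAlgebra p :=
  ((serreRelations_serreGen p).smul c).lift

@[simp]
theorem scaleHom_serreGen (p : K) (c : ℕ → K) (k : ℕ) :
    scaleHom p c (serreGen p k) = c k • serreGen p k := by
  simp [scaleHom]

/-- The matrix with rows `(a, x)` and `(0, s a)`. -/
def skewMatrix {A : Type*} [Ring A] [Algebra K A] (a x : A) (s : K) : Matrix (Fin 2) (Fin 2) A :=
  !![a, x; 0, s • a]

section SkewMatrix

variable {A : Type*} [Ring A] [Algebra K A]

theorem skewMatrix_mul (a b x y : A) (s u : K) :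
    skewMatrix a x s * skewMatrix b y u = skewMatrix (a * b) (a * y + u • (x * b)) (s * u) := by
  ext i j
  fin_cases i <;> fin_cases j <;>
    simp [skewMatrix, Matrix.mul_apply, Fin.sum_univ_two, smul_smul, mul_comm u]

theorem skewMatrix_add (a b x y : A) (s : K) :
    skewMatrix a x s + skewMatrix b y s = skewMatrix (a + b) (x + y) s := by
  ext i j
  fin_cases i <;> fin_cases j <;> simp [skewMatrix]

theorem skewMatrix_sub (a b x y : A) (s : K) :
    skewMatrix a x s - skewMatrix b y s = skewMatrix (a - b) (x - y) s := by
  ext i j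
  fin_cases i <;> fin_cases j <;> simp [skewMatrix, smul_sub]

theorem smul_skewMatrix (c : K) (a x : A) (s : K) :
    c • skewMatrix a x s = skewMatrix (c • a) (c • x) s := by
  ext i j
  fin_cases i <;> fin_cases j <;> simp [skewMatrix, smul_comm c s]

theorem skewMatrix_zero (s : K) : skewMatrix (0 : A) 0 s = 0 := by
  ext i j
  fin_cases i <;> fin_cases j <;> simp [skewMatrix]

theorem skewMatrix_mul_comm {a b : A} {α β s u : K} (h : a * b = b * a) (h1 : α * u = α)
    (h2 : β * s = β) :
    skewMatrix a (α • 1) s * skewMatrix b (β • 1) u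
      = skewMatrix b (β • 1) u * skewMatrix a (α • 1) s := by
  rw [skewMatrix_mul, skewMatrix_mul, h, mul_comm s u]
  congr 1
  simp only [mul_smul_comm, smul_mul_assoc, mul_one, one_mul, smul_smul, mul_comm u, mul_comm s,
    h1, h2]
  abel

/-- The diagonal entries are multiples of the Serre expression in a and b. The upper right entry is
a combination of a a, a b and b a, and the three hypotheses on scalars say that its coefficients
vanish. -/
theorem cubicSerre_skewMatrix {p : K} {a b : A} {α β s u : K}
    (h : cubicSerre p a b = 0) (h1 : β * (1 - (p + p⁻¹) * s + s ^ 2) = 0)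
    (h2 : α * ((1 + s) * u - (p + p⁻¹)) = 0) (h3 : α * (1 + s - (p + p⁻¹) * u * s) = 0) :
    cubicSerre p (skewMatrix a (α • 1) s) (skewMatrix b (β • 1) u) = 0 := by
  have key : cubicSerre p (skewMatrix a (α • 1) s) (skewMatrix b (β • 1) u)
      = skewMatrix (cubicSerre p a b) ((β * (1 - (p + p⁻¹) * s + s ^ 2)) • (a * a)
          + (α * ((1 + s) * u - (p + p⁻¹))) • (a * b)
          + (α * (1 + s - (p + p⁻¹) * u * s)) • (b * a)) (s * (s * u)) := by
    have e1 : s * (u * s) = s * (s * u) := by ring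
    have e2 : u * (s * s) = s * (s * u) := by ring
    simp only [cubicSerre, skewMatrix_mul, smul_skewMatrix, e1, e2, skewMatrix_sub, skewMatrix_add]
    congr 1
    simp only [mul_add, mul_smul_comm, smul_mul_assoc, mul_one, one_mul]
    module
  rw [key, h, h1, h2, h3]
  simp [skewMatrix_zero]

end SkewMatrix

theorem cartanNat_self (i : ℕ) : cartanNat i i = 2 := by simp [cartanNat]

theorem cartanNat_succ_right (i : ℕ) : cartanNat i (i + 1) = -1 := by simp [cartanNat]

theorem cartanNat_succ_left (i : ℕ) : cartanNat (i + 1) i = -1 := by simp [cartanNat]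

theorem cartanNat_of_lt {i j : ℕ} (h : i + 1 < j) : cartanNat i j = 0 := by
  rw [cartanNat, if_neg (by omega), if_neg (by omega)]

/-- For `P = p` or `P = p⁻¹`, the family defining the skew derivations of the Serre algebra. -/
theorem serreRelations_skewMatrix {A : Type*} [Ring A] [Algebra K A] {p P : K} (hP0 : P ≠ 0)
    (hP : p + p⁻¹ = P + P⁻¹) {E : ℕ → A} (hE : SerreRelations p E) (j : ℕ) :
    SerreRelations p fun k => skewMatrix (E k) ((if k = j then -1 else 0 : K) • 1)
      (P ^ cartanNat j k) := by
  refine ⟨fun i k h => ?_, fun i => ?_, fun i => ?_⟩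
  · refine skewMatrix_mul_comm (hE.comm i k h) ?_ ?_
    · split_ifs with hij
      · rw [← hij, cartanNat_of_lt h, zpow_zero, mul_one]
      · rw [zero_mul]
    · split_ifs with hij
      · rw [← hij, cartanNat_comm, cartanNat_of_lt h, zpow_zero, mul_one]
      · rw [zero_mul]
  · refine cubicSerre_skewMatrix (hE.cubic_succ i) ?_ ?_ ?_ <;> split_ifs with hij
    all_goals first
      | exact zero_mul _
      | rw [← hij, hP]
        simp only [cartanNat_self, cartanNat_succ_left, cartanNat_succ_right]
        field_simp
        ring
  · refine cubicSerre_skewMatrix (hE.cubic_pred i) ?_ ?_ ?_ <;> split_ifs with hij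
    all_goals first
      | exact zero_mul _
      | rw [← hij, hP]
        simp only [cartanNat_self, cartanNat_succ_left, cartanNat_succ_right]
        field_simp
        ring

/-- The upper right entry of the homomorphism to matrices: the skew derivation with
`E k ↦ -δ_jk`. -/
def skewDerivation {p P : K} (hP0 : P ≠ 0) (hP : p + p⁻¹ = P + P⁻¹) (j : ℕ) :
    Module.End K (SerreAlgebra p) where
  toFun r := (serreRelations_skewMatrix hP0 hP (serreRelations_serreGen p) j).lift r 0 1
  map_add' r s := by simp
  map_smul' c r := by simp

theorem skewDerivation_one {p P : K} (hP0 : P ≠ 0) (hP : p + p⁻¹ = P + P⁻¹) (j : ℕ) :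
    skewDerivation hP0 hP j 1 = 0 := by
  simp [skewDerivation]

theorem skewMatrix_lift_apply {p P : K} (hP0 : P ≠ 0) (hP : p + p⁻¹ = P + P⁻¹) (j : ℕ)
    (r : SerreAlgebra p) :
    (serreRelations_skewMatrix hP0 hP (serreRelations_serreGen p) j).lift r 1 1
      = scaleHom p (fun k => P ^ cartanNat j k) r := by
  let Z : Module.End K (SerreAlgebra p) :=
    { toFun := fun r => (serreRelations_skewMatrix hP0 hP (serreRelations_serreGen p) j).lift r 1 1
        - scaleHom p (fun k => P ^ cartanNat j k) r
      map_add' := fun r s => by simp; abel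
      map_smul' := fun c r => by simp [smul_sub] }
  refine sub_eq_zero.1 (LinearMap.congr_fun (SerreAlgebra.linearMap_eq_zero Z ?_ fun k => ?_) r)
  · simp [Z]
  · refine ⟨P ^ cartanNat j k, fun r => ?_⟩
    simp [Z, Matrix.mul_apply, Fin.sum_univ_two, skewMatrix, mul_sub, smul_sub]

/-- The twisted Leibniz rule is the upper right entry of a product of triangular matrices. -/
theorem skewDerivation_serreGen_mul {p P : K} (hP0 : P ≠ 0) (hP : p + p⁻¹ = P + P⁻¹) (j k : ℕ)
    (r : SerreAlgebra p) :
    skewDerivation hP0 hP j (serreGen p k * r) = serreGen p k * skewDerivation hP0 hP j r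
      - if k = j then scaleHom p (fun k => P ^ cartanNat j k) r else 0 := by
  simp only [skewDerivation, LinearMap.coe_mk, AddHom.coe_mk, map_mul, SerreRelations.lift_serreGen,
    Matrix.mul_apply, Fin.sum_univ_two]
  rw [skewMatrix_lift_apply hP0 hP]
  split_ifs <;> simp [skewMatrix, sub_eq_add_neg]

/-- The action of `E_k` on the Serre algebra. -/
def opE (p : K) (k : ℕ) : Module.End K (SerreAlgebra p) := LinearMap.mulLeft K (serreGen p k)

/-- The action of an element of the torus on the Serre algebra. -/
def opScale (p : K) (c : ℕ → K) : Module.End K (SerreAlgebra p) := (scaleHom p c).toLinearMap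

/-- The action of `F_j` on the Serre algebra. -/
def opF {p : K} (hp0 : p ≠ 0) (j : ℕ) : Module.End K (SerreAlgebra p) :=
  (p - p⁻¹)⁻¹ • (skewDerivation hp0 rfl j
    - skewDerivation (inv_ne_zero hp0) (by rw [inv_inv, add_comm]) j)

/-- The commutator of `E_j` and `F_j`. -/
def opH (p : K) (j : ℕ) : Module.End K (SerreAlgebra p) :=
  (p - p⁻¹)⁻¹ • (opScale p (fun k => p ^ cartanNat j k) - opScale p (fun k => p⁻¹ ^ cartanNat j k))

/-- The Serre algebra is generated from 1 by the operators `opE`. Identities between torus operators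
and the `opF` are therefore checked on 1 and on their commutation with `opE`. -/
theorem eq_of_mul_opE {p : K} {Y Z : Module.End K (SerreAlgebra p)} (h1 : Y 1 = Z 1)
    (h : ∀ k, ∃ c : K, (Y - Z) * opE p k = c • (opE p k * (Y - Z))) : Y = Z := by
  refine sub_eq_zero.1 (SerreAlgebra.linearMap_eq_zero _ (by simp [h1]) fun k => ?_)
  obtain ⟨c, hc⟩ := h k
  exact ⟨c, fun r => LinearMap.congr_fun hc r⟩

theorem opScale_mul_opE (p : K) (c : ℕ → K) (k : ℕ) :
    opScale p c * opE p k = c k • (opE p k * opScale p c) := by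
  refine LinearMap.ext fun r => ?_
  simp [opScale, opE]

theorem opScale_mul_opScale (p : K) (c d : ℕ → K) :
    opScale p c * opScale p d = opScale p (c * d) := by
  refine eq_of_mul_opE (by simp [opScale]) fun k => ⟨c k * d k, ?_⟩
  rw [sub_mul, mul_assoc, opScale_mul_opE, mul_smul_comm, ← mul_assoc, opScale_mul_opE,
    opScale_mul_opE, mul_sub, smul_sub, smul_mul_assoc, smul_smul, mul_assoc, mul_comm (d k)]
  rfl

theorem opScale_one (p : K) : opScale p 1 = 1 := by
  refine eq_of_mul_opE (by simp [opScale]) fun k => ⟨1, ?_⟩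
  rw [sub_mul, opScale_mul_opE, mul_sub]
  simp

/-- The two skew derivations in `opF` take the same values on generators but have the opposite
twists p and p⁻¹; their difference leaves precisely `opH`. -/
theorem opF_mul_opE {p : K} (hp0 : p ≠ 0) (j k : ℕ) :
    opF hp0 j * opE p k = opE p k * opF hp0 j - if k = j then opH p j else 0 := by
  refine LinearMap.ext fun r => ?_
  simp only [opF, opE, Module.End.mul_apply, LinearMap.smul_apply, LinearMap.sub_apply,
    LinearMap.mulLeft_apply, skewDerivation_serreGen_mul]
  split_ifs with h
  · simp only [opH, opScale, LinearMap.smul_apply, LinearMap.sub_apply, AlgHom.toLinearMap_apply,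
      mul_smul_comm, mul_sub]
    module
  · simp [mul_sub]

theorem opScale_mul_opH (p : K) (c : ℕ → K) (j : ℕ) :
    opScale p c * opH p j = opH p j * opScale p c := by
  simp only [opH, mul_smul_comm, smul_mul_assoc, mul_sub, sub_mul, opScale_mul_opScale, mul_comm c]

theorem opF_one {p : K} (hp0 : p ≠ 0) (j : ℕ) : opF hp0 j 1 = 0 := by
  simp [opF, skewDerivation_one]

theorem opScale_mul_opF {p : K} (hp0 : p ≠ 0) (c : ℕ → K) (j : ℕ) (hc : c j ≠ 0) :
    opScale p c * opF hp0 j = (c j)⁻¹ • (opF hp0 j * opScale p c) := by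
  refine eq_of_mul_opE (by simp [opScale, opF_one]) fun k => ⟨c k, ?_⟩
  rw [sub_mul, smul_mul_assoc, mul_assoc, opF_mul_opE, mul_assoc, opScale_mul_opE, mul_smul_comm,
    ← mul_assoc, opF_mul_opE, mul_sub, ← mul_assoc, opScale_mul_opE, mul_sub, sub_mul]
  split_ifs with h
  · subst h
    rw [opScale_mul_opH, smul_smul, inv_mul_cancel₀ hc]
    simp only [mul_smul_comm, smul_mul_assoc, mul_assoc, smul_sub, smul_smul, mul_inv_cancel₀ hc]
    module
  · simp only [mul_smul_comm, smul_mul_assoc, mul_assoc, smul_sub, smul_smul, mul_zero, zero_mul,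
      sub_zero, mul_comm]

theorem torus_qCommute_opF {p : K} (hp0 : p ≠ 0) (i j : ℕ) :
    QCommute (p ^ (-cartanNat i j)) (opScale p (fun k => p ^ cartanNat i k)) (opF hp0 j) ∧
      QCommute (p ^ cartanNat i j) (opScale p (fun k => p⁻¹ ^ cartanNat i k)) (opF hp0 j) := by
  refine ⟨?_, ?_⟩
  · rw [QCommute, opScale_mul_opF hp0 _ j (zpow_ne_zero _ hp0), zpow_neg]
  · rw [QCommute, opScale_mul_opF hp0 _ j (zpow_ne_zero _ (inv_ne_zero hp0)), inv_zpow, inv_inv]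

/-- Moving E to the left creates torus terms k and l, which are then moved to the right, where their
coefficients cancel. This lemma and the next two treat E_k against the Serre expression in F_i, F_j
for k = i, for k = j and for all other k. -/
theorem cubicSerre_mul_of_left {p c : K} {A : Type*} [Ring A] [Algebra K A] (hp0 : p ≠ 0)
    {E F G k l : A} (hF : F * E = E * F - c • (k - l)) (hG : G * E = E * G)
    (hkF : QCommute (p ^ 2)⁻¹ k F) (hlF : QCommute (p ^ 2) l F) (hkG : QCommute p k G)
    (hlG : QCommute p⁻¹ l G) : cubicSerre p F G * E = E * cubicSerre p F G := by
  unfold QCommute at hkF hlF hkG hlG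
  have hx : ∀ {s : K} {z a : A}, z * a = s • (a * z) → ∀ x, z * (a * x) = s • (a * (z * x)) :=
    fun h x => by rw [← mul_assoc, h, smul_mul_assoc, mul_assoc]
  have hFx : ∀ x, F * (E * x) = E * (F * x) - c • (k * x - l * x) := fun x => by
    rw [← mul_assoc, hF]
    simp only [sub_mul, smul_mul_assoc, mul_assoc]
  have hGx : ∀ x, G * (E * x) = E * (G * x) := fun x => by rw [← mul_assoc, hG, mul_assoc]
  rw [← sub_eq_zero]
  simp only [cubicSerre, sub_mul, add_mul, mul_add, mul_sub, smul_mul_assoc, mul_smul_comm,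
    mul_assoc, hF, hG, hFx, hGx, hkF, hlF, hkG, hlG, hx hkF, hx hlF, hx hkG, hx hlG, smul_sub]
  match_scalars <;> field_simp <;> ring

theorem cubicSerre_mul_of_right {p c : K} {A : Type*} [Ring A] [Algebra K A] (hp0 : p ≠ 0)
    {E F G k l : A} (hF : F * E = E * F) (hG : G * E = E * G - c • (k - l))
    (hkF : QCommute p k F) (hlF : QCommute p⁻¹ l F) :
    cubicSerre p F G * E = E * cubicSerre p F G := by
  unfold QCommute at hkF hlF
  have hx : ∀ {s : K} {z a : A}, z * a = s • (a * z) → ∀ x, z * (a * x) = s • (a * (z * x)) :=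
    fun h x => by rw [← mul_assoc, h, smul_mul_assoc, mul_assoc]
  have hGx : ∀ x, G * (E * x) = E * (G * x) - c • (k * x - l * x) := fun x => by
    rw [← mul_assoc, hG]
    simp only [sub_mul, smul_mul_assoc, mul_assoc]
  have hFx : ∀ x, F * (E * x) = E * (F * x) := fun x => by rw [← mul_assoc, hF, mul_assoc]
  rw [← sub_eq_zero]
  simp only [cubicSerre, sub_mul, add_mul, mul_add, mul_sub, smul_mul_assoc, mul_smul_comm,
    mul_assoc, hF, hG, hFx, hGx, hkF, hlF, hx hkF, hx hlF, smul_sub]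
  match_scalars <;> field_simp <;> ring

theorem cubicSerre_mul_of_commute {p : K} {A : Type*} [Ring A] [Algebra K A]
    {E F G : A} (hF : F * E = E * F) (hG : G * E = E * G) :
    cubicSerre p F G * E = E * cubicSerre p F G := by
  have hGx : ∀ x, G * (E * x) = E * (G * x) := fun x => by rw [← mul_assoc, hG, mul_assoc]
  have hFx : ∀ x, F * (E * x) = E * (F * x) := fun x => by rw [← mul_assoc, hF, mul_assoc]
  simp only [cubicSerre, sub_mul, add_mul, mul_add, mul_sub, smul_mul_assoc, mul_smul_comm,
    mul_assoc, hF, hG, hFx, hGx]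

/-- The Serre expression kills 1 and commutes with every `opE`, so it is zero. -/
theorem cubicSerre_opF {p : K} (hp0 : p ≠ 0) {i j : ℕ} (hij : cartanNat i j = -1) :
    cubicSerre p (opF hp0 i) (opF hp0 j) = 0 := by
  have hne : i ≠ j := by
    rintro rfl
    simp [cartanNat_self] at hij
  have hji : cartanNat j i = -1 := by rw [cartanNat_comm, hij]
  obtain ⟨h1, h2⟩ := torus_qCommute_opF hp0 i i
  obtain ⟨h3, h4⟩ := torus_qCommute_opF hp0 i j
  obtain ⟨h5, h6⟩ := torus_qCommute_opF hp0 j i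
  rw [cartanNat_self] at h1 h2
  rw [hij] at h3 h4
  rw [hji] at h5 h6
  refine eq_of_mul_opE (by simp [cubicSerre, opF_one]) fun k => ⟨1, ?_⟩
  rw [sub_zero, one_smul]
  by_cases hki : k = i
  · refine cubicSerre_mul_of_left hp0 (c := (p - p⁻¹)⁻¹)
      (k := opScale p fun k => p ^ cartanNat i k) (l := opScale p fun k => p⁻¹ ^ cartanNat i k)
      ?_ ?_ (by simpa using h1) (by simpa using h2) (by simpa using h3) (by simpa using h4)
    · rw [opF_mul_opE, if_pos hki, opH]
    · rw [opF_mul_opE, if_neg (by omega), sub_zero]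
  · by_cases hkj : k = j
    · refine cubicSerre_mul_of_right hp0 (c := (p - p⁻¹)⁻¹)
        (k := opScale p fun k => p ^ cartanNat j k) (l := opScale p fun k => p⁻¹ ^ cartanNat j k)
        ?_ ?_ (by simpa using h5) (by simpa using h6)
      · rw [opF_mul_opE, if_neg hki, sub_zero]
      · rw [opF_mul_opE, if_pos hkj, opH]
    · refine cubicSerre_mul_of_commute ?_ ?_
      · rw [opF_mul_opE, if_neg hki, sub_zero]
      · rw [opF_mul_opE, if_neg hkj, sub_zero]

theorem opH_commute_opF {p : K} (hp0 : p ≠ 0) {i j : ℕ} (hij : cartanNat i j = 0) :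
    opH p i * opF hp0 j = opF hp0 j * opH p i := by
  obtain ⟨h1, h2⟩ := torus_qCommute_opF hp0 i j
  rw [hij, neg_zero, zpow_zero, qCommute_one_iff] at h1
  rw [hij, zpow_zero, qCommute_one_iff] at h2
  simp only [opH, smul_mul_assoc, mul_smul_comm, sub_mul, mul_sub, h1, h2]

theorem serreRelations_opF {p : K} (hp0 : p ≠ 0) : SerreRelations p (opF hp0) := by
  refine ⟨fun i j h => ?_, fun i => cubicSerre_opF hp0 (cartanNat_succ_right i),
    fun i => cubicSerre_opF hp0 (cartanNat_succ_left i)⟩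
  have h1 := opH_commute_opF hp0 (cartanNat_of_lt h)
  have h2 := opH_commute_opF hp0 ((cartanNat_comm j i).trans (cartanNat_of_lt h))
  refine eq_of_mul_opE (by simp [opF_one]) fun k => ⟨1, ?_⟩
  -- The torus terms created by moving E_k to the left agree for both orders of the product, since
  -- H_i commutes with F_j when a_ij = 0.
  have hx : ∀ i j, opF hp0 i * opF hp0 j * opE p k = opE p k * (opF hp0 i * opF hp0 j)
      - (if k = i then opH p i else 0) * opF hp0 j
      - opF hp0 i * (if k = j then opH p j else 0) := fun i j => by
    rw [mul_assoc, opF_mul_opE, mul_sub, ← mul_assoc, opF_mul_opE, sub_mul, mul_assoc]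
  rw [one_smul, sub_mul, hx, hx, mul_sub]
  split_ifs with hi hj hj
  · omega
  · rw [h1]
    simp
  · rw [h2]
    simp
  · simp

end SerreAlgebra

/-! ### Action of the quantum group, Chevalley involution and independence of ordered monomials -/

section QuantumGroupAction

variable {K : Type*} [Field K]

theorem cartanMatrix_apply {N : ℕ} (i j : Fin N) : CartanMatrix.A N i j = cartanNat i j := by
  simp [CartanMatrix.A, cartanNat, Fin.ext_iff]

theorem quantumSerre_zero {A : Type*} [Ring A] [Algebra K A] (t : K) (x y : A) :
    quantumSerre t 0 x y = x * y - y * x := by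
  simp [quantumSerre, quantumBinomial, Finset.sum_range_succ, sub_eq_add_neg]

theorem quantumSerre_neg_one {A : Type*} [Ring A] [Algebra K A] {t : K} (ht : t - t⁻¹ ≠ 0)
    (x y : A) : quantumSerre t (-1) x y = cubicSerre t x y := by
  have h0 : t ≠ 0 := by
    rintro rfl
    simp at ht
  have h1 : (t ^ (2 : ℤ) - t ^ (-2 : ℤ)) / (t - t⁻¹) = t + t⁻¹ := by
    rw [div_eq_iff ht, zpow_neg]
    field_simp
    norm_cast
    ring
  have h2 : quantumBinomial t 2 1 = t + t⁻¹ := by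
    rw [← h1]
    simp [quantumBinomial]
  have h3 : (1 - (-1) : ℤ).toNat = 2 := rfl
  rw [quantumSerre, h3, Finset.sum_range_succ, Finset.sum_range_succ, Finset.sum_range_one, h2]
  simp [cubicSerre, quantumBinomial, pow_two, mul_assoc, sub_eq_add_neg, -neg_add_rev]

/-- The extension by zero of a family indexed by `Fin N`. -/
def extendZero {A : Type*} [Zero A] {N : ℕ} (e : Fin N → A) (k : ℕ) : A :=
  if h : k < N then e ⟨k, h⟩ else 0

theorem extendZero_apply {A : Type*} [Zero A] {N : ℕ} (e : Fin N → A) (i : Fin N) :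
    extendZero e i = e i := by
  simp [extendZero]

theorem serreRelations_extendZero {A : Type*} [Ring A] [Algebra K A] {N : ℕ} {p : K}
    (hp1 : p - p⁻¹ ≠ 0) {e : Fin N → A}
    (h : ∀ i j, i ≠ j → quantumSerre p (CartanMatrix.A N i j) (e i) (e j) = 0) :
    SerreRelations p (extendZero e) := by
  have hcub : ∀ i j, cartanNat i j = -1 → cubicSerre p (extendZero e i) (extendZero e j) = 0 := by
    intro i j hij
    by_cases hi : i < N
    · by_cases hj : j < N
      · have hne : (⟨i, hi⟩ : Fin N) ≠ ⟨j, hj⟩ := by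
          intro hne
          rw [Fin.mk.injEq] at hne
          rw [hne, cartanNat_self] at hij
          omega
        have := h _ _ hne
        rw [cartanMatrix_apply, hij, quantumSerre_neg_one hp1] at this
        simpa [extendZero, hi, hj] using this
      · simp [extendZero, hj, cubicSerre]
    · simp [extendZero, hi, cubicSerre]
  refine ⟨fun i j hij => ?_, fun i => hcub _ _ (cartanNat_succ_right i),
    fun i => hcub _ _ (cartanNat_succ_left i)⟩
  by_cases hj : j < N
  · have hi : i < N := by omega
    have := h ⟨i, hi⟩ ⟨j, hj⟩ (by simp; omega)
    rw [cartanMatrix_apply, cartanNat_of_lt hij, quantumSerre_zero, sub_eq_zero] at this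
    simpa [extendZero, hi, hj] using this
  · simp [extendZero, hj]

theorem SerreRelations.quantumSerre_eq_zero {A : Type*} [Ring A] [Algebra K A] {p : K}
    (hp1 : p - p⁻¹ ≠ 0) {E : ℕ → A} (hE : SerreRelations p E) {N : ℕ} (i j : Fin N) (hij : i ≠ j) :
    quantumSerre p (CartanMatrix.A N i j) (E i) (E j) = 0 := by
  have hij' : (i : ℕ) ≠ j := fun h => hij (Fin.ext h)
  rw [cartanMatrix_apply]
  by_cases h1 : (i : ℕ) + 1 = j
  · rw [← h1, cartanNat_succ_right, quantumSerre_neg_one hp1, hE.cubic_succ]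
  by_cases h2 : (j : ℕ) + 1 = i
  · rw [← h2, cartanNat_succ_left, quantumSerre_neg_one hp1, hE.cubic_pred]
  rw [cartanNat, if_neg hij', if_neg (by omega), quantumSerre_zero, sub_eq_zero]
  exact hE.comm_symm (by omega)

theorem map_quantumSerre {A B : Type*} [Ring A] [Algebra K A] [Ring B] [Algebra K B]
    (φ : A →ₐ[K] B) (t : K) (c : ℤ) (a b : A) :
    φ (quantumSerre t c a b) = quantumSerre t c (φ a) (φ b) := by
  simp [quantumSerre]

theorem quantumSerre_quantumE {N : ℕ} (q : K) (i j : Fin N) (hij : i ≠ j) :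
    quantumSerre (q ^ 2) (CartanMatrix.A N i j) (quantumE q i) (quantumE q j) = 0 := by
  have := RingQuot.mkAlgHom_rel K (QuantumRel.serre_e (q := q) i j hij)
  rwa [map_quantumSerre, map_zero] at this

theorem quantumSerre_quantumF {N : ℕ} (q : K) (i j : Fin N) (hij : i ≠ j) :
    quantumSerre (q ^ 2) (CartanMatrix.A N i j) (quantumF q i) (quantumF q j) = 0 := by
  have := RingQuot.mkAlgHom_rel K (QuantumRel.serre_f (q := q) i j hij)
  rwa [map_quantumSerre, map_zero] at this

/-- The images of the generators of the quantum group in the endomorphisms of the Serre algebra. -/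
def actionGen (N : ℕ) {q : K} (hq0 : q ≠ 0) : QuantumGen N → Module.End K (SerreAlgebra (q ^ 2))
  | .genE i => opE (q ^ 2) i
  | .genF i => opF (pow_ne_zero 2 hq0) i
  | .genK i => opScale (q ^ 2) fun k => q ^ cartanNat i k
  | .genKInv i => opScale (q ^ 2) fun k => q ^ (-cartanNat i k)

theorem serreRelations_opE (p : K) : SerreRelations p (opE p) := by
  have h : opE p = fun k => Algebra.lmul K (SerreAlgebra p) (serreGen p k) := rfl
  have hS := serreRelations_serreGen p
  rw [h]
  refine ⟨fun i j hij => ?_, fun i => ?_, fun i => ?_⟩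
  · rw [← map_mul, hS.comm i j hij, map_mul]
  · rw [← map_cubicSerre, hS.cubic_succ, map_zero]
  · rw [← map_cubicSerre, hS.cubic_pred, map_zero]

/-- The action of the quantum group on the Serre algebra. -/
def quantumAction (N : ℕ) {q : K} (hq0 : q ≠ 0) (hp1 : q ^ 2 - (q ^ 2)⁻¹ ≠ 0) :
    QuantumGroup N q →ₐ[K] Module.End K (SerreAlgebra (q ^ 2)) :=
  RingQuot.liftAlgHom K ⟨FreeAlgebra.lift K (actionGen N hq0), fun _ _ h => by
    have hinv : ∀ i : Fin N,
        ((fun k => q ^ cartanNat i k) * fun k => q ^ (-cartanNat i k) : ℕ → K) = 1 := fun i => by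
      ext k
      simp [zpow_ne_zero _ hq0]
    cases h with
    | k_comm i j => simp [actionGen, opScale_mul_opScale, mul_comm]
    | k_kInv i =>
      simp only [map_mul, map_one, FreeAlgebra.lift_ι_apply, actionGen, opScale_mul_opScale]
      rw [hinv, opScale_one]
    | kInv_k i =>
      simp only [map_mul, map_one, FreeAlgebra.lift_ι_apply, actionGen, opScale_mul_opScale]
      rw [mul_comm, hinv, opScale_one]
    | e_k i j =>
      simp only [map_mul, map_smul, FreeAlgebra.lift_ι_apply, actionGen, opScale_mul_opE, smul_smul,
        cartanMatrix_apply, ← zpow_add₀ hq0, neg_add_cancel, zpow_zero, one_smul]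
    | e_kInv i j =>
      simp only [map_mul, map_smul, FreeAlgebra.lift_ι_apply, actionGen, opScale_mul_opE, smul_smul,
        cartanMatrix_apply, ← zpow_add₀ hq0, add_neg_cancel, zpow_zero, one_smul]
    | k_f i j =>
      simp only [map_mul, map_smul, FreeAlgebra.lift_ι_apply, actionGen, cartanMatrix_apply]
      rw [opScale_mul_opF _ _ _ (zpow_ne_zero _ hq0), zpow_neg]
    | kInv_f i j =>
      simp only [map_mul, map_smul, FreeAlgebra.lift_ι_apply, actionGen, cartanMatrix_apply]
      rw [opScale_mul_opF _ _ _ (zpow_ne_zero _ hq0), zpow_neg, inv_inv]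
    | e_f i j =>
      -- K_i scales by powers of q, so its square scales by the powers of p = q² that occur in
      -- `opH`; likewise for the inverse.
      have h1 : ∀ i : ℕ, ((fun k => q ^ cartanNat i k) * fun k => q ^ cartanNat i k : ℕ → K)
          = fun k => (q ^ 2) ^ cartanNat i k := fun i => by
        ext k
        rw [Pi.mul_apply, ← mul_zpow, pow_two]
      have h2 : ∀ i : ℕ, ((fun k => q ^ (-cartanNat i k)) * fun k => q ^ (-cartanNat i k) : ℕ → K)
          = fun k => (q ^ 2)⁻¹ ^ cartanNat i k := fun i => by
        ext k
        rw [Pi.mul_apply, ← mul_zpow, zpow_neg, inv_zpow, pow_two]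
      simp only [map_mul, map_sub, FreeAlgebra.lift_ι_apply, actionGen, opF_mul_opE, sub_sub_cancel]
      split_ifs with h3 h4 h4
      · subst h4
        simp only [map_smul, map_sub, map_pow, FreeAlgebra.lift_ι_apply, actionGen, opH]
        rw [pow_two (opScale (q ^ 2) fun k => q ^ cartanNat i k),
          pow_two (opScale (q ^ 2) fun k => q ^ (-cartanNat i k)), opScale_mul_opScale,
          opScale_mul_opScale, h1, h2]
      · exact absurd (Fin.ext h3) h4
      · exact absurd (congrArg Fin.val h4) h3
      · simp
    | serre_e i j hij =>
      simpa [map_quantumSerre, actionGen] using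
        (serreRelations_opE (q ^ 2)).quantumSerre_eq_zero hp1 i j hij
    | serre_f i j hij =>
      simpa [map_quantumSerre, actionGen] using
        (serreRelations_opF (pow_ne_zero 2 hq0)).quantumSerre_eq_zero hp1 i j hij⟩

theorem quantumAction_quantumE (N : ℕ) {q : K} (hq0 : q ≠ 0) (hp1 : q ^ 2 - (q ^ 2)⁻¹ ≠ 0)
    (i : Fin N) : quantumAction N hq0 hp1 (quantumE q i) = opE (q ^ 2) i :=
  (RingQuot.liftAlgHom_mkAlgHom_apply K _ _ _).trans (by simp [actionGen])

/-- Both products are inverse to a b. The Chevalley involution sends K_i to K_i⁻¹, while the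
defining relations only provide commutation of the K_i. -/
theorem inverse_mul_comm {M : Type*} [Monoid M] {a b a' b' : M} (h : a * b = b * a)
    (h1 : a * a' = 1) (h2 : a' * a = 1) (h3 : b * b' = 1) (h4 : b' * b = 1) :
    a' * b' = b' * a' := by
  refine left_inv_eq_right_inv (a := a * b) ?_ ?_
  · rw [h, mul_assoc, ← mul_assoc b', h4, one_mul, h2]
  · rw [mul_assoc, ← mul_assoc b, h3, one_mul, h1]

open QuantumGen in
/-- The images of the generators under the Chevalley involution. -/
def involutionGen (N : ℕ) (q : K) : QuantumGen N → QuantumGroup N q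
  | genE i => quantumF q i
  | genF i => quantumE q i
  | genK i => RingQuot.mkAlgHom K (QuantumRel N q) (FreeAlgebra.ι K (genKInv i))
  | genKInv i => RingQuot.mkAlgHom K (QuantumRel N q) (FreeAlgebra.ι K (genK i))

/-- The Chevalley involution, exchanging the `E_i` and the `F_i`. -/
def chevalleyHom (N : ℕ) {q : K} (hq0 : q ≠ 0) : QuantumGroup N q →ₐ[K] QuantumGroup N q :=
  RingQuot.liftAlgHom K ⟨FreeAlgebra.lift K (involutionGen N q), fun _ _ h => by
    have rel := fun {a b} (h : QuantumRel N q a b) => RingQuot.mkAlgHom_rel K h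
    cases h with
    | k_comm i j =>
      have h1 := rel (.k_comm i j)
      have h2 := rel (.k_kInv i)
      have h3 := rel (.kInv_k i)
      have h4 := rel (.k_kInv j)
      have h5 := rel (.kInv_k j)
      simp only [map_mul, map_one] at h1 h2 h3 h4 h5
      simp only [map_mul, FreeAlgebra.lift_ι_apply, involutionGen]
      exact inverse_mul_comm h1 h2 h3 h4 h5
    | k_kInv i => simpa [involutionGen] using rel (.kInv_k i)
    | kInv_k i => simpa [involutionGen] using rel (.k_kInv i)
    | e_k i j =>
      have := rel (.kInv_f i j)
      simp only [map_mul, map_smul] at this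
      simp only [map_mul, map_smul, FreeAlgebra.lift_ι_apply, involutionGen, quantumF]
      rw [this, smul_smul, ← zpow_add₀ hq0, neg_add_cancel, zpow_zero, one_smul]
    | e_kInv i j =>
      have := rel (.k_f i j)
      simp only [map_mul, map_smul] at this
      simp only [map_mul, map_smul, FreeAlgebra.lift_ι_apply, involutionGen, quantumF]
      rw [this, smul_smul, ← zpow_add₀ hq0, add_neg_cancel, zpow_zero, one_smul]
    | k_f i j =>
      have := rel (.e_kInv i j)
      simp only [map_mul, map_smul] at this
      simp only [map_mul, map_smul, FreeAlgebra.lift_ι_apply, involutionGen, quantumE]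
      rw [this, smul_smul, ← zpow_add₀ hq0, neg_add_cancel, zpow_zero, one_smul]
    | kInv_f i j =>
      have := rel (.e_k i j)
      simp only [map_mul, map_smul] at this
      simp only [map_mul, map_smul, FreeAlgebra.lift_ι_apply, involutionGen, quantumE]
      rw [this, smul_smul, ← zpow_add₀ hq0, add_neg_cancel, zpow_zero, one_smul]
    | e_f i j =>
      have := rel (.e_f j i)
      simp only [map_mul, map_sub] at this
      simp only [map_mul, map_sub, FreeAlgebra.lift_ι_apply, involutionGen, quantumE, quantumF]
      -- The sign from reversing the commutator is matched by the exchange of K_i and K_i⁻¹.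
      rw [← neg_sub, this]
      by_cases hij : i = j
      · subst hij
        simp only [if_true, map_smul, map_sub, map_pow, FreeAlgebra.lift_ι_apply, involutionGen]
        exact (smul_neg _ _).symm.trans (congrArg _ (neg_sub _ _))
      · simp [hij, Ne.symm hij]
    | serre_e i j hij =>
      simpa [map_quantumSerre, involutionGen] using quantumSerre_quantumF q i j hij
    | serre_f i j hij =>
      simpa [map_quantumSerre, involutionGen] using quantumSerre_quantumE q i j hij⟩

theorem chevalleyHom_quantumF (N : ℕ) {q : K} (hq0 : q ≠ 0) (i : Fin N) :
    chevalleyHom N hq0 (quantumF q i) = quantumE q i :=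
  (RingQuot.liftAlgHom_mkAlgHom_apply K _ _ _).trans (by simp [involutionGen])

theorem wordProd_congr {A : Type*} [Ring A] [Algebra K A] {N : ℕ} (q : K) {D E : ℕ → A}
    (h : ∀ k < N, D k = E k) (w : List (RootIndex N)) : wordProd q D w = wordProd q E w := by
  have hx : ∀ i j, i < j → j ≤ N → rootVector q D i j = rootVector q E i j := by
    intro i j hij
    induction j, hij using Nat.le_induction with
    | base => exact fun hN => by rw [rootVector_simple, rootVector_simple, h i (by omega)]
    | succ j hj ih =>
      intro hN
      rw [rootVector_succ q D hj, rootVector_succ q E hj, ih (by omega), h j (by omega)]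
  rw [wordProd, wordProd]
  congr 1
  exact List.map_congr_left fun a _ => hx _ _ a.2 (by omega)

/-- The ordered monomials are linearly independent in an algebra that acts on the Serre algebra
through the multiplication by the generators. -/
theorem linearIndependent_wordProd_of_action {A : Type*} [Ring A] [Algebra K A] {N : ℕ} {q : K}
    (hq0 : q ≠ 0) (hp1 : q ^ 2 - (q ^ 2)⁻¹ ≠ 0) (e : Fin N → A)
    (ρ : A →ₐ[K] Module.End K (SerreAlgebra (q ^ 2))) (hρ : ∀ i, ρ (e i) = opE (q ^ 2) i) :
    LinearIndependent K fun w : {w : List (RootIndex N) // IsOrderedWord w} =>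
      wordProd q (extendZero e) w.1 := by
  obtain ⟨W, _, _, E, w₀, hE, -, hli⟩ :=
    exists_linearIndependent_wordProd hq0 rfl hp1 N 0 (Nat.zero_le N)
  -- An element of A is applied to 1, which turns a monomial in the e_i into the same monomial of
  -- the Serre algebra; the latter then acts on w₀.
  let Φ : A →ₗ[K] W := (LinearMap.applyₗ w₀).comp (hE.lift.toLinearMap.comp
      ((LinearMap.applyₗ (1 : SerreAlgebra (q ^ 2))).comp ρ.toLinearMap))
  have hΦ : ∀ w : List (RootIndex N), Φ (wordProd q (extendZero e) w) = wordProd q E w w₀ := by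
    intro w
    have h1 : ρ (wordProd q (extendZero e) w)
        = Algebra.lmul K _ (wordProd q (serreGen (q ^ 2)) w) := by
      rw [wordProd_map, wordProd_map]
      refine wordProd_congr q (fun k hk => ?_) w
      rw [extendZero, dif_pos hk, hρ]
      rfl
    have h2 : Algebra.lmul K _ (wordProd q (serreGen (q ^ 2)) w) 1
        = wordProd q (serreGen (q ^ 2)) w := mul_one _
    change hE.lift (ρ _ 1) w₀ = _
    rw [h1, h2, wordProd_map]
    simp
  refine LinearIndependent.of_comp Φ ?_
  have := hli.comp (fun w : {w : List (RootIndex N) // IsOrderedWord w} =>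
    ⟨w.1, w.2, fun _ _ => Nat.zero_le _⟩) fun v w h => Subtype.ext (by simpa using h)
  convert this using 1
  funext w
  exact hΦ w.1

theorem LinearIndependent.wordProd_of_map {A B : Type*} [Ring A] [Algebra K A] [Ring B]
    [Algebra K B] {N : ℕ} {q : K} {e : Fin N → A} {f : Fin N → B} (φ : B →ₐ[K] A)
    (hφ : ∀ i, φ (f i) = e i)
    (h : LinearIndependent K fun w : {w : List (RootIndex N) // IsOrderedWord w} =>
      wordProd q (extendZero e) w.1) :
    LinearIndependent K fun w : {w : List (RootIndex N) // IsOrderedWord w} =>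
      wordProd q (extendZero f) w.1 := by
  refine LinearIndependent.of_comp φ.toLinearMap ?_
  convert h using 1
  funext w
  simp only [Function.comp_apply, AlgHom.toLinearMap_apply, wordProd_map]
  refine wordProd_congr q (fun k hk => ?_) w.1
  rw [extendZero, extendZero, dif_pos hk, dif_pos hk, hφ]

end QuantumGroupAction

/-! ### Reduction to normal words -/

section Groebner

variable {K σ : Type*} [Field K]

theorem basisFreeMonoid_eq_lift (w : FreeMonoid σ) :
    FreeAlgebra.basisFreeMonoid K σ w = FreeMonoid.lift (FreeAlgebra.ι K) w := by
  simp [FreeAlgebra.basisFreeMonoid, FreeAlgebra.equivMonoidAlgebraFreeMonoid]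

theorem basisFreeMonoid_mul (u v : FreeMonoid σ) : FreeAlgebra.basisFreeMonoid K σ (u * v)
    = FreeAlgebra.basisFreeMonoid K σ u * FreeAlgebra.basisFreeMonoid K σ v := by
  simp only [basisFreeMonoid_eq_lift, map_mul]

theorem basisFreeMonoid_of (s : σ) :
    FreeAlgebra.basisFreeMonoid K σ (FreeMonoid.of s) = FreeAlgebra.ι K s := by
  simp only [basisFreeMonoid_eq_lift, FreeMonoid.lift_eval_of]

/-- The span of the words in a set. -/
def wordSpan (K : Type*) {σ : Type*} [Field K] (s : Set (FreeMonoid σ)) :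
    Submodule K (FreeAlgebra K σ) :=
  Submodule.span K (FreeAlgebra.basisFreeMonoid K σ '' s)

theorem mem_wordSpan_iff {s : Set (FreeMonoid σ)} {f : FreeAlgebra K σ} :
    f ∈ wordSpan K s ↔ ∀ v, (FreeAlgebra.basisFreeMonoid K σ).repr f v ≠ 0 → v ∈ s := by
  rw [wordSpan, Module.Basis.mem_span_image]
  simp [Set.subset_def]

theorem basis_mem_wordSpan {s : Set (FreeMonoid σ)} {w : FreeMonoid σ} (h : w ∈ s) :
    FreeAlgebra.basisFreeMonoid K σ w ∈ wordSpan K s :=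
  Submodule.subset_span ⟨w, h, rfl⟩

theorem wordSpan_mono {s t : Set (FreeMonoid σ)} (h : s ⊆ t) : wordSpan K s ≤ wordSpan K t :=
  Submodule.span_mono (Set.image_mono h)

theorem TwoSidedIdeal.smul_mem' {A : Type*} [Ring A] [Algebra K A] (I : TwoSidedIdeal A) (c : K)
    {f : A} (hf : f ∈ I) : c • f ∈ I := by
  rw [Algebra.smul_def]
  exact I.mul_mem_left _ _ hf

variable {r : FreeMonoid σ → FreeMonoid σ → Prop}

theorem IsLeadingMonomial.eq (hr : IsMonomialOrdering r) {f : FreeAlgebra K σ} {v w : FreeMonoid σ}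
    (hv : IsLeadingMonomial r f v) (hw : IsLeadingMonomial r f w) : v = w := by
  have := hr.isWellOrder
  by_contra hne
  exact asymm (hw.2 v hv.1 hne) (hv.2 w hw.1 (Ne.symm hne))

theorem isLeadingMonomial_of_sub_mem (hr : IsMonomialOrdering r) {g : FreeAlgebra K σ}
    {u : FreeMonoid σ} (h : FreeAlgebra.basisFreeMonoid K σ u - g ∈ wordSpan K {v | r v u}) :
    IsLeadingMonomial r g u := by
  classical
  have := hr.isWellOrder
  rw [mem_wordSpan_iff] at h
  simp only [map_sub, Module.Basis.repr_self, Finsupp.sub_apply, Finsupp.single_apply,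
    Set.mem_ofPred_eq] at h
  refine ⟨fun h0 => ?_, fun v hv hne => h v ?_⟩
  · exact irrefl (r := r) u (h u (by simp [h0]))
  · rw [if_neg (Ne.symm hne), zero_sub]
    exact neg_ne_zero.2 hv

theorem leadingMonomials_eq (hr : IsMonomialOrdering r) {G : Set (FreeAlgebra K σ)}
    {B : Set (FreeMonoid σ)}
    (hB : ∀ u ∈ B, ∃ g ∈ G, FreeAlgebra.basisFreeMonoid K σ u - g ∈ wordSpan K {v | r v u})
    (hG : ∀ g ∈ G, ∃ u ∈ B, FreeAlgebra.basisFreeMonoid K σ u - g ∈ wordSpan K {v | r v u}) :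
    leadingMonomials r G = B := by
  ext w
  refine ⟨fun ⟨g, hg, hw⟩ => ?_, fun hw => ?_⟩
  · obtain ⟨u, hu, h⟩ := hG g hg
    rwa [hw.eq hr (isLeadingMonomial_of_sub_mem hr h)]
  · obtain ⟨g, hg, h⟩ := hB w hw
    exact ⟨g, hg, isLeadingMonomial_of_sub_mem hr h⟩

/-- The words that have no factor in `B`. -/
def normalWords (B : Set (FreeMonoid σ)) : Set (FreeMonoid σ) :=
  {w | ∀ u ∈ B, ∀ a b, w ≠ a * u * b}

theorem exists_normal_of_forall {I : TwoSidedIdeal (FreeAlgebra K σ)} {s t : Set (FreeMonoid σ)}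
    (h : ∀ w ∈ s, ∃ g ∈ wordSpan K t, FreeAlgebra.basisFreeMonoid K σ w - g ∈ I)
    {f : FreeAlgebra K σ} (hf : f ∈ wordSpan K s) : ∃ g ∈ wordSpan K t, f - g ∈ I := by
  induction hf using Submodule.span_induction with
  | mem x hx =>
    obtain ⟨w, hw, rfl⟩ := hx
    exact h w hw
  | zero => exact ⟨0, Submodule.zero_mem _, by rw [sub_zero]; exact I.zero_mem⟩
  | add x y _ _ hx hy =>
    obtain ⟨g, hg, hxg⟩ := hx
    obtain ⟨g', hg', hyg⟩ := hy
    exact ⟨g + g', Submodule.add_mem _ hg hg', by rw [add_sub_add_comm]; exact I.add_mem hxg hyg⟩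
  | smul c x _ hx =>
    obtain ⟨g, hg, hxg⟩ := hx
    exact ⟨c • g, Submodule.smul_mem _ c hg, by rw [← smul_sub]; exact I.smul_mem' c hxg⟩

theorem mul_mul_mem_wordSpan {s t : Set (FreeMonoid σ)} (a b : FreeMonoid σ)
    (h : ∀ v ∈ s, a * v * b ∈ t) {f : FreeAlgebra K σ} (hf : f ∈ wordSpan K s) :
    FreeAlgebra.basisFreeMonoid K σ a * f * FreeAlgebra.basisFreeMonoid K σ b ∈ wordSpan K t := by
  induction hf using Submodule.span_induction with
  | mem x hx =>
    obtain ⟨w, hw, rfl⟩ := hx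
    rw [← basisFreeMonoid_mul, ← basisFreeMonoid_mul]
    exact basis_mem_wordSpan (h w hw)
  | zero => simp
  | add x y _ _ hx hy =>
    rw [mul_add, add_mul]
    exact Submodule.add_mem _ hx hy
  | smul c x _ hx =>
    rw [mul_smul_comm, smul_mul_assoc]
    exact Submodule.smul_mem _ c hx

/-- Well-founded induction: a factor in B is replaced by smaller words, which keeps all words below
w. The bound by w is recorded because the Gröbner property depends on it. -/
theorem exists_normal_word (hr : IsMonomialOrdering r) {G : Set (FreeAlgebra K σ)}
    {B : Set (FreeMonoid σ)}
    (hB : ∀ u ∈ B, ∃ g ∈ G, FreeAlgebra.basisFreeMonoid K σ u - g ∈ wordSpan K {v | r v u})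
    (w : FreeMonoid σ) :
    ∃ g ∈ wordSpan K {v | v ∈ normalWords B ∧ (v = w ∨ r v w)},
      FreeAlgebra.basisFreeMonoid K σ w - g ∈ TwoSidedIdeal.span G := by
  have := hr.isWellOrder
  induction w using (IsWellFounded.wf (r := r)).induction with
  | _ w ih =>
    by_cases hw : w ∈ normalWords B
    · refine ⟨_, basis_mem_wordSpan ⟨hw, Or.inl rfl⟩, ?_⟩
      rw [sub_self]
      exact TwoSidedIdeal.zero_mem _
    · simp only [normalWords, Set.mem_ofPred_eq, not_forall, not_not] at hw
      obtain ⟨u, hu, a, b, rfl⟩ := hw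
      obtain ⟨g, hg, ht⟩ := hB u hu
      have h1 := mul_mul_mem_wordSpan (t := {v | r v (a * u * b)}) a b
        (fun v hv => hr.mul_lt_mul v u a b hv) ht
      obtain ⟨g', hg', h2⟩ := exists_normal_of_forall
        (t := {v | v ∈ normalWords B ∧ (v = a * u * b ∨ r v (a * u * b))}) (fun v hv => by
          obtain ⟨g, hg, h⟩ := ih v hv
          refine ⟨g, wordSpan_mono (fun x hx => ?_) hg, h⟩
          refine ⟨hx.1, Or.inr ?_⟩
          rcases hx.2 with rfl | hx
          · exact hv
          · exact _root_.trans hx hv) h1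
      refine ⟨g', hg', ?_⟩
      have h3 : FreeAlgebra.basisFreeMonoid K σ a * g * FreeAlgebra.basisFreeMonoid K σ b
          ∈ TwoSidedIdeal.span G :=
        TwoSidedIdeal.mul_mem_right _ _ _
          (TwoSidedIdeal.mul_mem_left _ _ _ (TwoSidedIdeal.subset_span hg))
      have h4 := TwoSidedIdeal.add_mem _ h2 h3
      rw [mul_sub, sub_mul, ← basisFreeMonoid_mul, ← basisFreeMonoid_mul] at h4
      convert h4 using 1
      abel

section

variable (hr : IsMonomialOrdering r) {G : Set (FreeAlgebra K σ)} {B : Set (FreeMonoid σ)}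
  (hB : ∀ u ∈ B, ∃ g ∈ G, FreeAlgebra.basisFreeMonoid K σ u - g ∈ wordSpan K {v | r v u})
  (hG : ∀ g ∈ G, ∃ u ∈ B, FreeAlgebra.basisFreeMonoid K σ u - g ∈ wordSpan K {v | r v u})
  {A : Type*} [Ring A] [Algebra K A] (φ : FreeAlgebra K σ →ₐ[K] A) (hφ : ∀ g ∈ G, φ g = 0)
  (hli : LinearIndependent K fun w : normalWords B => φ (FreeAlgebra.basisFreeMonoid K σ w))

include hφ in
theorem map_eq_zero_of_mem_span {f : FreeAlgebra K σ} (hf : f ∈ TwoSidedIdeal.span G) :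
    φ f = 0 := by
  have h : TwoSidedIdeal.span G ≤ TwoSidedIdeal.ker φ :=
    TwoSidedIdeal.span_le.2 fun g hg => (TwoSidedIdeal.mem_ker φ).2 (hφ g hg)
  exact (TwoSidedIdeal.mem_ker φ).1 (h hf)

include hli in
theorem eq_zero_of_mem_wordSpan {g : FreeAlgebra K σ} (hg : g ∈ wordSpan K (normalWords B))
    (h0 : φ g = 0) : g = 0 := by
  rw [wordSpan, Set.image_eq_range, Finsupp.mem_span_range_iff_exists_finsupp] at hg
  obtain ⟨c, rfl⟩ := hg
  have hc : c = 0 := by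
    refine linearIndependent_iff.1 hli c ?_
    rw [Finsupp.linearCombination_apply, ← h0, map_finsuppSum]
    simp
  simp [hc]

include hr hB hφ hli

/-- A relation f is congruent to a combination of normal words, which φ also kills; by independence
that combination is zero, so f lies in the ideal. -/
theorem map_eq_zero_iff_mem_span (f : FreeAlgebra K σ) :
    φ f = 0 ↔ f ∈ TwoSidedIdeal.span G := by
  refine ⟨fun h => ?_, map_eq_zero_of_mem_span φ hφ⟩
  obtain ⟨g, hg, hfg⟩ := exists_normal_of_forall (s := Set.univ) (t := normalWords B)
    (I := TwoSidedIdeal.span G) (fun w _ => by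
      obtain ⟨g, hg, h⟩ := exists_normal_word hr hB w
      exact ⟨g, wordSpan_mono (fun x hx => hx.1) hg, h⟩)
    (f := f) (mem_wordSpan_iff.2 fun _ _ => Set.mem_univ _)
  have h1 := map_eq_zero_of_mem_span φ hφ hfg
  rw [map_sub, h, zero_sub, neg_eq_zero] at h1
  rwa [eq_zero_of_mem_wordSpan φ hli hg h1, sub_zero] at hfg

include hG in
-- Suppose the leading word w of f is normal. Reducing only the tail of f gives c w + g with g
-- supported on normal words below w. This is killed by φ, hence zero, contradicting c ≠ 0.
theorem isGroebnerBasis_of_linearIndependent :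
    IsGroebnerBasis r G (TwoSidedIdeal.span G) := by
  classical
  have := hr.isWellOrder
  refine ⟨fun g hg => TwoSidedIdeal.subset_span hg, fun f hf _ w hw => ?_⟩
  rw [leadingMonomials_eq hr hB hG]
  by_contra hcon
  have hwn : w ∈ normalWords B := fun u hu a b h => hcon ⟨u, hu, a, b, h⟩
  set c := (FreeAlgebra.basisFreeMonoid K σ).repr f w with hc
  have ht : f - c • FreeAlgebra.basisFreeMonoid K σ w ∈ wordSpan K {v | r v w} := by
    rw [mem_wordSpan_iff]
    intro v hv
    by_cases hvw : v = w
    · subst hvw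
      simp [hc] at hv
    · refine hw.2 v ?_ hvw
      simpa [Finsupp.single_apply, Ne.symm hvw] using hv
  obtain ⟨g, hg, hfg⟩ := exists_normal_of_forall (t := {v | v ∈ normalWords B ∧ r v w})
    (I := TwoSidedIdeal.span G) (fun v hv => by
      obtain ⟨g, hg, h⟩ := exists_normal_word hr hB v
      refine ⟨g, wordSpan_mono (fun x hx => ?_) hg, h⟩
      refine ⟨hx.1, ?_⟩
      rcases hx.2 with rfl | hx
      · exact hv
      · exact _root_.trans hx hv) ht
  have h1 : c • FreeAlgebra.basisFreeMonoid K σ w + g ∈ wordSpan K (normalWords B) :=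
    Submodule.add_mem _ (Submodule.smul_mem _ _ (basis_mem_wordSpan hwn))
      (wordSpan_mono (fun x hx => hx.1) hg)
  have h2 : φ (c • FreeAlgebra.basisFreeMonoid K σ w + g) = 0 := by
    have h3 := map_eq_zero_of_mem_span φ hφ (TwoSidedIdeal.sub_mem _ hf hfg)
    rwa [sub_sub_eq_add_sub, add_sub_sub_cancel, add_comm g] at h3
  have h4 := DFunLike.congr_fun (congrArg (FreeAlgebra.basisFreeMonoid K σ).repr
    (eq_zero_of_mem_wordSpan φ hli h1 h2)) w
  have h5 : (FreeAlgebra.basisFreeMonoid K σ).repr g w = 0 := by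
    by_contra hne
    exact irrefl (r := r) w (mem_wordSpan_iff.1 hg w hne).2
  refine hw.1 ?_
  simpa [h5] using h4

end

end Groebner

/-! ### The degree-lexicographic ordering and the Jimbo relations -/

section Shortlex

variable {σ : Type*}

/-- Equal lengths exclude that u is a proper prefix of v, in which case appending could reverse the
comparison. -/
theorem List.Lex.append_of_length_eq {s : σ → σ → Prop} {u v : List σ} (h : List.Lex s u v)
    (hl : u.length = v.length) (e : List σ) : List.Lex s (u ++ e) (v ++ e) := by
  induction h with
  | nil => simp at hl
  | cons _ ih => exact List.Lex.cons (ih (by simpa using hl))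
  | rel h => exact List.Lex.rel h

theorem isMonomialOrdering_shortlex {s : σ → σ → Prop} [IsWellOrder σ s] :
    IsMonomialOrdering fun u v : FreeMonoid σ =>
      List.Shortlex s (FreeMonoid.toList u) (FreeMonoid.toList v) := by
  refine ⟨?_, fun a b e c _ hbc hc => ?_, fun a b c e hab => ?_⟩
  · have h1 : IsWellOrder (List σ) (List.Shortlex s) :=
      { wf := List.Shortlex.wf IsWellFounded.wf }
    exact h1
  · subst hc
    refine List.Shortlex.of_length_lt ?_
    simp only [FreeMonoid.toList_mul, List.length_append]
    by_contra h
    have ha : FreeMonoid.toList a = [] := List.length_eq_zero_iff.1 (by omega)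
    have he : FreeMonoid.toList e = [] := List.length_eq_zero_iff.1 (by omega)
    refine hbc (FreeMonoid.toList.injective ?_)
    simp [FreeMonoid.toList_mul, ha, he]
  · simp only [FreeMonoid.toList_mul, List.append_assoc]
    refine List.Shortlex.append_left ?_ _
    rcases List.shortlex_def.1 hab with h | ⟨h1, h2⟩
    · exact List.Shortlex.of_length_lt (by simpa using h)
    · exact List.Shortlex.of_lex (by simpa using h1) (h2.append_of_length_eq h1 _)

end Shortlex

section JimboRelations

variable {K : Type*} [Field K] {N : ℕ}

instance : IsWellOrder (RootIndex N) LexLT where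
  trichotomous _ _ h1 h2 := eq_of_not_lexLT h1 h2
  wf := by
    have : (LexLT : RootIndex N → RootIndex N → Prop)
        = InvImage (· < ·) fun a : RootIndex N => toLex a.1 := by
      ext a b
      exact lexLT_iff
    rw [this]
    exact InvImage.wf _ wellFounded_lt

/-- The degree-lexicographic ordering on words. -/
def wordLT (N : ℕ) (u v : FreeMonoid (RootIndex N)) : Prop :=
  List.Shortlex LexLT (FreeMonoid.toList u) (FreeMonoid.toList v)

/-- The words of length two that are not weakly increasing. -/
def descents (N : ℕ) : Set (FreeMonoid (RootIndex N)) :=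
  {w | ∃ a b : RootIndex N, LexLT a b ∧ w = FreeMonoid.of b * FreeMonoid.of a}

theorem wordLT_pair_of_lexLT {a b c d : RootIndex N} (h : LexLT c b) :
    wordLT N (FreeMonoid.of c * FreeMonoid.of d) (FreeMonoid.of b * FreeMonoid.of a) :=
  List.Shortlex.of_lex rfl (List.Lex.rel h)

theorem wordLT_letter (a b c : RootIndex N) :
    wordLT N (FreeMonoid.of c) (FreeMonoid.of b * FreeMonoid.of a) :=
  List.Shortlex.of_length_lt (by simp [FreeMonoid.toList_mul])

/-- The six conditions exhaust the relative positions of two intervals, so every descent is the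
leading word of some Jimbo relation. -/
theorem mem_jimbo_of_lexLT {a b : RootIndex N} (h : LexLT a b) :
    (a, b) ∈ jimboC1 N ∪ jimboC2 N ∪ jimboC3 N ∪ jimboC4 N ∪ jimboC5 N ∪ jimboC6 N := by
  obtain ⟨⟨i, j⟩, hij⟩ := a
  obtain ⟨⟨m, n⟩, hmn⟩ := b
  simp only [LexLT, jimboC1, jimboC2, jimboC3, jimboC4, jimboC5, jimboC6, Set.mem_union,
    Set.mem_ofPred_eq] at h hij hmn ⊢
  omega

theorem letter_mul_letter (a b : RootIndex N) : FreeAlgebra.ι K a * FreeAlgebra.ι K b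
    = FreeAlgebra.basisFreeMonoid K _ (FreeMonoid.of a * FreeMonoid.of b) := by
  rw [basisFreeMonoid_mul, basisFreeMonoid_of, basisFreeMonoid_of]

theorem mul_letters_mem_wordSpan {a b c d : RootIndex N} (h : LexLT c b) :
    FreeAlgebra.ι K c * FreeAlgebra.ι K d
      ∈ wordSpan K {v | wordLT N v (FreeMonoid.of b * FreeMonoid.of a)} := by
  rw [letter_mul_letter]
  exact basis_mem_wordSpan (wordLT_pair_of_lexLT h)

theorem letter_mem_wordSpan (a b c : RootIndex N) :
    FreeAlgebra.ι K c ∈ wordSpan K {v | wordLT N v (FreeMonoid.of b * FreeMonoid.of a)} := by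
  rw [← basisFreeMonoid_of]
  exact basis_mem_wordSpan (wordLT_letter _ _ _)

/-- The Jimbo relation `g` has the form `X_b X_a - f` with `f` a combination of smaller words. -/
def IsJimboRelationFor (a b : RootIndex N) (g : FreeAlgebra K (RootIndex N)) : Prop :=
  LexLT a b ∧ FreeAlgebra.basisFreeMonoid K _ (FreeMonoid.of b * FreeMonoid.of a) - g
    ∈ wordSpan K {v | wordLT N v (FreeMonoid.of b * FreeMonoid.of a)}

section

variable {q : K} {i j m n : Fin (N + 1)} {hij : i < j} {hmn : m < n}

/-- In this lemma and the next three, the remaining words either have length two and a first letter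
smaller than X_{mn}, or are a single letter. -/
theorem isJimboRelationFor_c13 (h : ((⟨(i, j), hij⟩, ⟨(m, n), hmn⟩) : RootIndex N × RootIndex N)
    ∈ jimboC1 N ∪ jimboC3 N) :
    IsJimboRelationFor ⟨(i, j), hij⟩ ⟨(m, n), hmn⟩ (letterX K m n hmn * letterX K i j hij
        - (q ^ 2)⁻¹ • (letterX K i j hij * letterX K m n hmn)) := by
  have hlt : LexLT (⟨(i, j), hij⟩ : RootIndex N) ⟨(m, n), hmn⟩ := by
    simp only [LexLT, jimboC1, jimboC3, Set.mem_union, Set.mem_ofPred_eq] at h ⊢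
    omega
  refine ⟨hlt, ?_⟩
  rw [letterX, letterX, ← letter_mul_letter, sub_sub_cancel]
  exact Submodule.smul_mem _ _ (mul_letters_mem_wordSpan hlt)

theorem isJimboRelationFor_c26 (h : ((⟨(i, j), hij⟩, ⟨(m, n), hmn⟩) : RootIndex N × RootIndex N)
    ∈ jimboC2 N ∪ jimboC6 N) :
    IsJimboRelationFor ⟨(i, j), hij⟩ ⟨(m, n), hmn⟩ (letterX K m n hmn * letterX K i j hij
        - letterX K i j hij * letterX K m n hmn) := by
  have hlt : LexLT (⟨(i, j), hij⟩ : RootIndex N) ⟨(m, n), hmn⟩ := by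
    simp only [LexLT, jimboC2, jimboC6, Set.mem_union, Set.mem_ofPred_eq] at h ⊢
    omega
  refine ⟨hlt, ?_⟩
  rw [letterX, letterX, ← letter_mul_letter, sub_sub_cancel]
  exact mul_letters_mem_wordSpan hlt

theorem isJimboRelationFor_c4 (hin : i < n) (hmj : m < j)
    (h : ((⟨(i, j), hij⟩, ⟨(m, n), hmn⟩) : RootIndex N × RootIndex N) ∈ jimboC4 N) :
    IsJimboRelationFor ⟨(i, j), hij⟩ ⟨(m, n), hmn⟩ (letterX K m n hmn * letterX K i j hij
        - letterX K i j hij * letterX K m n hmn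
        + (q ^ 2 - (q ^ 2)⁻¹) • (letterX K i n hin * letterX K m j hmj)) := by
  have him : i < m := h.1
  refine ⟨Or.inl him, ?_⟩
  rw [letterX, letterX, letterX, letterX, ← letter_mul_letter, ← sub_sub, sub_sub_cancel]
  exact Submodule.sub_mem _ (mul_letters_mem_wordSpan (Or.inl him))
    (Submodule.smul_mem _ _ (mul_letters_mem_wordSpan (Or.inl him)))

theorem isJimboRelationFor_c5 (hin : i < n)
    (h : ((⟨(i, j), hij⟩, ⟨(m, n), hmn⟩) : RootIndex N × RootIndex N) ∈ jimboC5 N) :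
    IsJimboRelationFor ⟨(i, j), hij⟩ ⟨(m, n), hmn⟩ (letterX K m n hmn * letterX K i j hij
        - q ^ 2 • (letterX K i j hij * letterX K m n hmn) + q • letterX K i n hin) := by
  have him : i < m := hij.trans_eq h.2.1
  refine ⟨Or.inl him, ?_⟩
  rw [letterX, letterX, letterX, ← letter_mul_letter, ← sub_sub, sub_sub_cancel]
  exact Submodule.sub_mem _ (Submodule.smul_mem _ _ (mul_letters_mem_wordSpan (Or.inl him)))
    (Submodule.smul_mem _ _ (letter_mem_wordSpan _ _ _))

end

theorem exists_descent_of_jimboRelation {q : K} {g : FreeAlgebra K (RootIndex N)}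
    (hg : JimboRelation N q g) : ∃ u ∈ descents N,
      FreeAlgebra.basisFreeMonoid K _ u - g ∈ wordSpan K {v | wordLT N v u} := by
  obtain ⟨a, b, hab⟩ : ∃ a b, IsJimboRelationFor a b g := by
    cases hg with
    | f13 i j m n hij hmn h => exact ⟨_, _, isJimboRelationFor_c13 h⟩
    | f26 i j m n hij hmn h => exact ⟨_, _, isJimboRelationFor_c26 h⟩
    | f4 i j m n hij hmn hin hmj h => exact ⟨_, _, isJimboRelationFor_c4 hin hmj h⟩
    | f5 i j m n hij hmn hin h => exact ⟨_, _, isJimboRelationFor_c5 hin h⟩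
  exact ⟨_, ⟨a, b, hab.1, rfl⟩, hab.2⟩

theorem exists_jimboRelation (q : K) {u : FreeMonoid (RootIndex N)} (hu : u ∈ descents N) :
    ∃ g ∈ jimboRelations N q,
      FreeAlgebra.basisFreeMonoid K _ u - g ∈ wordSpan K {v | wordLT N v u} := by
  obtain ⟨⟨⟨i, j⟩, hij⟩, ⟨⟨m, n⟩, hmn⟩, hlt, rfl⟩ := hu
  simp only at hij hmn
  rcases mem_jimbo_of_lexLT hlt with ((((h | h) | h) | h) | h) | h
  · exact ⟨_, .f13 i j m n hij hmn (Or.inl h), (isJimboRelationFor_c13 (Or.inl h)).2⟩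
  · exact ⟨_, .f26 i j m n hij hmn (Or.inl h), (isJimboRelationFor_c26 (Or.inl h)).2⟩
  · exact ⟨_, .f13 i j m n hij hmn (Or.inr h), (isJimboRelationFor_c13 (Or.inr h)).2⟩
  · have hmj : m < j := h.2.1
    have hin : i < n := hij.trans h.2.2
    exact ⟨_, .f4 i j m n hij hmn hin hmj h, (isJimboRelationFor_c4 hin hmj h).2⟩
  · have hin : i < n := (hij.trans_eq h.2.1).trans hmn
    exact ⟨_, .f5 i j m n hij hmn hin h, (isJimboRelationFor_c5 hin h).2⟩
  · exact ⟨_, .f26 i j m n hij hmn (Or.inr h), (isJimboRelationFor_c26 (Or.inr h)).2⟩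

/-- The relation "not greater" is transitive since the lexicographic ordering is total. So it is
enough to compare adjacent letters, and an adjacent descent would be a forbidden factor. -/
theorem isOrderedWord_of_mem_normalWords {w : FreeMonoid (RootIndex N)}
    (hw : w ∈ normalWords (descents N)) : IsOrderedWord (FreeMonoid.toList w) := by
  have : IsTrans (RootIndex N) fun a b => ¬ LexLT b a := ⟨fun a b c h1 h2 => by
    rw [lexLT_iff, not_lt] at *
    exact h1.trans h2⟩
  rw [IsOrderedWord, ← List.isChain_iff_pairwise]
  induction w using FreeMonoid.recOn with
  | one => exact List.isChain_nil
  | of_mul a w ih =>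
    have ih := ih fun u hu c d h => hw u hu (FreeMonoid.of a * c) d (by rw [h]; simp [mul_assoc])
    rw [FreeMonoid.toList_of_mul, List.isChain_cons]
    refine ⟨fun b hb hlt => ?_, ih⟩
    obtain ⟨l, hl⟩ : ∃ l, FreeMonoid.toList w = b :: l := by
      cases hw' : FreeMonoid.toList w with
      | nil => simp [hw'] at hb
      | cons c l => exact ⟨l, by simpa [hw'] using hb⟩
    refine hw _ ⟨b, a, hlt, rfl⟩ 1 (FreeMonoid.ofList l) (FreeMonoid.toList.injective ?_)
    simp [FreeMonoid.toList_mul, hl]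

section

variable {A : Type*} [Ring A] [Algebra K A] {q : K} {E : ℕ → A}

/-- The root vectors indexed by the pairs `i < j`. -/
def rootFamily (N : ℕ) (q : K) (E : ℕ → A) (a : RootIndex N) : A := rootVector q E a.1.1 a.1.2

theorem lift_rootFamily_jimbo (hq0 : q ≠ 0) (hp2 : q ^ 2 + (q ^ 2)⁻¹ ≠ 0)
    (hE : SerreRelations (q ^ 2) E) (g : FreeAlgebra K (RootIndex N))
    (hg : g ∈ jimboRelations N q) :
    FreeAlgebra.lift K (rootFamily N q E) g = 0 := by
  cases hg with
  | f13 i j m n hij hmn h =>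
    simp only [letterX, map_sub, map_mul, map_smul, FreeAlgebra.lift_ι_apply, rootFamily]
    rw [sub_eq_zero]
    rcases h with h | h
    · simp only [jimboC1, Set.mem_ofPred_eq] at h
      obtain ⟨rfl, h1, h2⟩ := h
      exact hE.qCommute_of_same_left hq0 rfl hp2 h1 h2
    · simp only [jimboC3, Set.mem_ofPred_eq] at h
      obtain ⟨h1, h2, rfl⟩ := h
      exact hE.qCommute_of_same_right hq0 rfl hp2 h1 h2
  | f26 i j m n hij hmn h =>
    simp only [letterX, map_sub, map_mul, FreeAlgebra.lift_ι_apply, rootFamily]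
    rw [sub_eq_zero]
    rcases h with h | h
    · exact hE.commute_of_nested hq0 rfl hp2 h.1 h.2.1 h.2.2
    · exact hE.commute_of_disjoint h.1 h.2.1 h.2.2
  | f4 i j m n hij hmn hin hmj h =>
    simp only [letterX, map_sub, map_add, map_mul, map_smul, FreeAlgebra.lift_ι_apply, rootFamily]
    rw [hE.mul_of_overlap hq0 rfl hp2 h.1 h.2.1 h.2.2]
    abel
  | f5 i j m n hij hmn hin h =>
    simp only [jimboC5, Set.mem_ofPred_eq] at h
    obtain ⟨h1, rfl, h2⟩ := h
    simp only [letterX, map_sub, map_add, map_mul, map_smul, FreeAlgebra.lift_ι_apply, rootFamily]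
    rw [hE.mul_of_adjacent hq0 rfl h1 h2]
    abel

theorem lift_rootFamily_basis (w : FreeMonoid (RootIndex N)) :
    FreeAlgebra.lift K (rootFamily N q E) (FreeAlgebra.basisFreeMonoid K _ w)
      = wordProd q E (FreeMonoid.toList w) := by
  induction w using FreeMonoid.recOn with
  | one => simp [basisFreeMonoid_eq_lift, wordProd]
  | of_mul a w ih =>
    rw [basisFreeMonoid_mul, map_mul, ih, basisFreeMonoid_of, FreeAlgebra.lift_ι_apply,
      FreeMonoid.toList_of_mul, wordProd, wordProd, List.map_cons, List.prod_cons, rootFamily]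

theorem linearIndependent_normalWords
    (hli : LinearIndependent K fun w : {w : List (RootIndex N) // IsOrderedWord w} =>
      wordProd q E w.1) :
    LinearIndependent K fun w : normalWords (descents N) =>
      FreeAlgebra.lift K (rootFamily N q E) (FreeAlgebra.basisFreeMonoid K _ w) := by
  simp only [lift_rootFamily_basis]
  exact hli.comp (fun w : normalWords (descents N) =>
    ⟨FreeMonoid.toList w.1, isOrderedWord_of_mem_normalWords w.2⟩) fun v w h =>
      Subtype.ext (FreeMonoid.toList.injective (by simpa using h))

theorem isMonomialOrdering_wordLT (N : ℕ) : IsMonomialOrdering (wordLT N) :=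
  isMonomialOrdering_shortlex

theorem isDefiningSet_rootFamily (hq0 : q ≠ 0) (hp1 : q ^ 2 - (q ^ 2)⁻¹ ≠ 0)
    (hp2 : q ^ 2 + (q ^ 2)⁻¹ ≠ 0) {e : Fin N → A}
    (h : ∀ i j, i ≠ j → quantumSerre (q ^ 2) (CartanMatrix.A N i j) (e i) (e j) = 0)
    (hli : LinearIndependent K fun w : {w : List (RootIndex N) // IsOrderedWord w} =>
      wordProd q (extendZero e) w.1) :
    IsDefiningSet (Algebra.adjoin K (Set.range e)) (rootFamily N q (extendZero e))
      (jimboRelations N q) := by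
  have hE := serreRelations_extendZero hp1 h
  refine ⟨le_antisymm ?_ ?_, map_eq_zero_iff_mem_span (isMonomialOrdering_wordLT N)
    (fun _ hu => exists_jimboRelation q hu) _ (lift_rootFamily_jimbo hq0 hp2 hE)
    (linearIndependent_normalWords hli)⟩
  · rw [Algebra.adjoin_le_iff]
    rintro _ ⟨a, rfl⟩
    refine rootVector_mem _ q _ (fun k => ?_) _ _
    rw [extendZero]
    split_ifs with hk
    · exact Algebra.subset_adjoin ⟨_, rfl⟩
    · exact Subalgebra.zero_mem _
  · refine Algebra.adjoin_mono ?_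
    rintro _ ⟨i, rfl⟩
    refine ⟨simpleIndex i, ?_⟩
    simp [rootFamily, simpleIndex, extendZero_apply]

theorem isGroebnerBasis_jimboRelations (hq0 : q ≠ 0) (hp2 : q ^ 2 + (q ^ 2)⁻¹ ≠ 0)
    (hE : SerreRelations (q ^ 2) E)
    (hli : LinearIndependent K fun w : {w : List (RootIndex N) // IsOrderedWord w} =>
      wordProd q E w.1) :
    IsGroebnerBasis (wordLT N) (jimboRelations N q) (TwoSidedIdeal.span (jimboRelations N q)) :=
  isGroebnerBasis_of_linearIndependent (isMonomialOrdering_wordLT N)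
    (fun _ hu => exists_jimboRelation q hu) (fun _ hg => exists_descent_of_jimboRelation hg) _
    (lift_rootFamily_jimbo hq0 hp2 hE) (linearIndependent_normalWords hli)

end

end JimboRelations

theorem proposition3p1 {K : Type*} [Field K] [CharZero K] (N : ℕ) (hN : 0 < N)
    (q : K) (hq0 : q ≠ 0) (hq : q ^ 8 ≠ 1) :
    (∃ x : RootIndex N → QuantumGroup N q,
      (∀ i : Fin N, x (simpleIndex i) = quantumE q i) ∧
        IsDefiningSet (quantumPlus N q) x (jimboRelations N q)) ∧
    (∃ y : RootIndex N → QuantumGroup N q,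
      (∀ i : Fin N, y (simpleIndex i) = quantumF q i) ∧
        IsDefiningSet (quantumMinus N q) y (jimboRelations N q)) ∧
    ∃ r : FreeMonoid (RootIndex N) → FreeMonoid (RootIndex N) → Prop,
      IsMonomialOrdering r ∧
      IsGroebnerBasis r (jimboRelations N q) (TwoSidedIdeal.span (jimboRelations N q)) ∧
      leadingMonomials r (jimboRelations N q) =
        {w | ∃ a b : RootIndex N,
          (a, b) ∈ jimboC1 N ∪ jimboC2 N ∪ jimboC3 N ∪ jimboC4 N ∪ jimboC5 N ∪ jimboC6 N ∧
          LexLT a b ∧ w = FreeMonoid.of b * FreeMonoid.of a} := by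
  -- The cases c = 1 and c = -1 reduce the two nonvanishing conditions to q⁴ ≠ 1 and q⁴ ≠ -1, both
  -- of which follow from q⁸ ≠ 1.
  have hmul : ∀ c : K, (q ^ 2 - c * (q ^ 2)⁻¹) * q ^ 2 = q ^ 4 - c := fun c => by
    field_simp
  have hp1 : q ^ 2 - (q ^ 2)⁻¹ ≠ 0 := fun h => hq (by
    have h4 := hmul 1
    rw [one_mul, h, zero_mul] at h4
    linear_combination (-1 - q ^ 4) * h4)
  have hp2 : q ^ 2 + (q ^ 2)⁻¹ ≠ 0 := fun h => hq (by
    have h4 := hmul (-1)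
    rw [neg_one_mul, sub_neg_eq_add, h, zero_mul] at h4
    linear_combination (1 - q ^ 4) * h4)
  have hliE := linearIndependent_wordProd_of_action hq0 hp1 (quantumE (N := N) q)
    (quantumAction N hq0 hp1) (quantumAction_quantumE N hq0 hp1)
  have hliF := hliE.wordProd_of_map (chevalleyHom N hq0) (chevalleyHom_quantumF N hq0)
  have hsimple : ∀ (e : Fin N → QuantumGroup N q) (i : Fin N),
      rootFamily N q (extendZero e) (simpleIndex i) = e i := fun e i => by
    simp [rootFamily, simpleIndex, extendZero_apply]
  refine ⟨⟨_, hsimple _, isDefiningSet_rootFamily hq0 hp1 hp2 (quantumSerre_quantumE q) hliE⟩,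
    ⟨_, hsimple _, isDefiningSet_rootFamily hq0 hp1 hp2 (quantumSerre_quantumF q) hliF⟩,
    wordLT N, isMonomialOrdering_wordLT N, isGroebnerBasis_jimboRelations hq0 hp2
      (serreRelations_extendZero hp1 (quantumSerre_quantumE q)) hliE, ?_⟩
  rw [leadingMonomials_eq (isMonomialOrdering_wordLT N) (fun _ hu => exists_jimboRelation q hu)
    fun _ hg => exists_descent_of_jimboRelation hg]
  ext w
  exact ⟨fun ⟨a, b, h, hw⟩ => ⟨a, b, mem_jimbo_of_lexLT h, h, hw⟩,
    fun ⟨a, b, _, h, hw⟩ => ⟨a, b, h, hw⟩⟩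

end
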